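/- All graphs are finite and simple. An ordered graph is a graph together with a linear order on its vertex set; the complement $\overline{H}$ of an ordered graph $H$ is the complement graph with the same vertex order, and an ordered forest is an ordered graph with no cycles. An ordered graph $G$ is $H$-free if there is no isomorphism from $H$ to an induced subgraph of $G$ that preserves the vertex order. A pure pair in $G$ is a pair $(Z_1,Z_2)$ of disjoint sets of vertices such that either every vertex of $Z_1$ is adjacent to every vertex of $Z_2$, or there are no edges between $Z_1$ and $Z_2$. Write $|G|$ for the number of vertices of $G$. For every ordered forest $T$ and every real $c>0$ there exists $\varepsilon>0$ such that every ordered graph $G$ with $|G|>1$ that is both $T$-free and $\overline{T}$-free contains a pure pair $(Z_1,Z_2)$ with $|Z_1|,|Z_2|\ge\varepsilon|G|^{1-c}$. -/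

import Mathlib

namespace OrderedGraph

/-- An ordered graph is a `SimpleGraph V` on a linearly ordered vertex type `V`.
`G` contains `H` if there is an isomorphism of `H` onto an induced subgraph of `G` that carries
the order of `V(H)` to the inherited order: an induced graph embedding that is strictly
increasing on vertices. -/
def Contains {W V : Type*} [LinearOrder W] [LinearOrder V]
    (G : SimpleGraph W) (H : SimpleGraph V) : Prop :=
  ∃ f : H ↪g G, StrictMono f

/-- `G` is `H`-free, as ordered graphs. -/
def IsFree {W V : Type*} [LinearOrder W] [LinearOrder V]
    (G : SimpleGraph W) (H : SimpleGraph V) : Prop :=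
  ¬ Contains G H

/-- Two disjoint vertex sets are complete to each other. -/
def IsComplete {W : Type*} (G : SimpleGraph W) (Z₁ Z₂ : Finset W) : Prop :=
  Disjoint Z₁ Z₂ ∧ ∀ x ∈ Z₁, ∀ y ∈ Z₂, G.Adj x y

/-- Two disjoint vertex sets are anticomplete to each other. -/
def IsAnticomplete {W : Type*} (G : SimpleGraph W) (Z₁ Z₂ : Finset W) : Prop :=
  Disjoint Z₁ Z₂ ∧ ∀ x ∈ Z₁, ∀ y ∈ Z₂, ¬ G.Adj x y

/-- A pure pair: two disjoint vertex sets, complete or anticomplete to each other. -/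
def IsPurePair {W : Type*} (G : SimpleGraph W) (Z₁ Z₂ : Finset W) : Prop :=
  IsComplete G Z₁ Z₂ ∨ IsAnticomplete G Z₁ Z₂

end OrderedGraph

/-! By a Rödl-type theorem (`exists_isSparseSeq`), a `T`-free graph or its complement contains a
long sequence of consecutive blocks of linear size with small density between any two. The
complement is `T`-free too, so it is enough to find a large anticomplete pair when `G` itself has
such a sequence.

The engine is `exists_drop`: if no correctly ordered tuple of blocks contains a copy of a tree, then
some `q` blocks can be shrunk by a factor `r ^ l` so that relative degrees fall by `r ^ (C * l)`.
Iterating this with `r` a small power of `|G|` and `C > 2 / c` pushes relative degrees below `1 /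
|G|`, so that no edge is left, while the blocks lose at most a factor `|G| ^ c`.

To obtain a drop, embed `T` in a tree and build the tree leaf by leaf. With relative degrees at most
`Δ`, the benchmark for a tree with `i` edges is `Δ ^ i` times the product of the block sizes. A
tuple of blocks is rich if it comes within a factor `r ^ e` of the benchmark, robustly under
shrinking. Suppose that rich tuples exist for `i` edges but none of the candidate extensions is
rich. After shrinking, most copies then have few extensions. A greedy cover (`exists_cover`) selects
about `δ / Δ` vertices in each block except that of the parent `w` of the new leaf, such that copies
using only selected vertices still take many values at `w`. The selected set `U` has neighbours in
only a small part of the target blocks, and outside this part every neighbour of `f w` extends the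
copy `f`. Few extensions therefore mean low degree (`exists_sparse_part`), which is the drop
(`drops_of_low`). If no drop ever occurs, the whole tree becomes rich and so has a copy, a
contradiction. -/

namespace OrderedGraph
open Finset
open scoped Classical

/-! ### Greedy covers of families of tuples -/

/-- In a bipartite relation `P` in which every left vertex has at most `m` partners, some set of
at most `s` right vertices meets a proportional share of the left vertices. -/
lemma exists_greedy_cover {Ω α : Type*} [DecidableEq Ω] [DecidableEq α]
    (P : Finset (Ω × α)) (S : Finset α)
    (hP : ∀ e ∈ P, e.2 ∈ S) (m s : ℕ) (hm : ∀ o, #{e ∈ P | e.1 = o} ≤ m)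
    (hs : s * m ≤ #S) :
    ∃ X ⊆ S, #X ≤ s ∧ s * #P ≤ 2 * #S * #({e ∈ P | e.2 ∈ X}.image Prod.fst) := by
  suffices H : ∀ t ≤ s, ∃ X ⊆ S, #X ≤ t ∧
      t * #P ≤ 2 * #S * #({e ∈ P | e.2 ∈ X}.image Prod.fst) from H s le_rfl
  intro t
  induction t with
  | zero => intro _; exact ⟨∅, by simp, by simp, by simp⟩
  | succ t ih =>
    intro ht
    obtain ⟨X, hXS, hXt, hX⟩ := ih (by omega)
    set cov := ({e ∈ P | e.2 ∈ X}.image Prod.fst) with hcov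
    -- If `cov` already has size at least `#P / (2 * m)`, then `s * m ≤ #S` finishes. Otherwise the
    -- covered vertices account for less than half of the pairs, and an average right vertex covers
    -- at least `#P / (2 * #S)` new left vertices.
    by_cases hbig : #P ≤ 2 * m * #cov
    · refine ⟨X, hXS, by omega, ?_⟩
      calc (t + 1) * #P ≤ s * (2 * m * #cov) := Nat.mul_le_mul ht hbig
        _ = 2 * (s * m) * #cov := by ring
        _ ≤ 2 * #S * #cov := by gcongr
    · push Not at hbig
      set P' := {e ∈ P | e.1 ∉ cov} with hP'
      have h1 : #P ≤ #P' + m * #cov := by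
        have hsplit : #{e ∈ P | e.1 ∈ cov} + #P' = #P := by
          rw [hP']; convert card_filter_add_card_filter_not (s := P) (fun e => e.1 ∈ cov)
        have : #{e ∈ P | e.1 ∈ cov} ≤ m * #cov := by
          have := card_le_mul_card_image_of_maps_to (s := {e ∈ P | e.1 ∈ cov}) (t := cov)
            (f := Prod.fst) (by simp) m (by
              intro b hb
              refine le_trans (card_le_card ?_) (hm b)
              intro e; simp; tauto)
          simpa [mul_comm] using this
        omega
      have hP'pos : 0 < #P' := by nlinarith
      have hne : S.Nonempty := by
        obtain ⟨e, he⟩ := card_pos.mp hP'pos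
        exact ⟨e.2, hP e (mem_filter.mp he).1⟩
      have hsum : #P' = ∑ x ∈ S, #{e ∈ P' | e.2 = x} :=
        card_eq_sum_card_fiberwise (fun e he => hP e (mem_filter.mp he).1)
      obtain ⟨x, hxS, hx⟩ : ∃ x ∈ S, #P' ≤ #S * #{e ∈ P' | e.2 = x} := by
        by_contra! hcon
        have : ∑ x ∈ S, #S * #{e ∈ P' | e.2 = x} < ∑ x ∈ S, #P' :=
          sum_lt_sum_of_nonempty hne hcon
        rw [← mul_sum, ← hsum] at this
        simp at this
      refine ⟨insert x X, insert_subset hxS hXS, (card_insert_le _ _).trans (by omega), ?_⟩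
      have h2 : #cov + #{e ∈ P' | e.2 = x} ≤
          #({e ∈ P | e.2 ∈ insert x X}.image Prod.fst) := by
        have hinj : #({e ∈ P' | e.2 = x}.image Prod.fst) = #{e ∈ P' | e.2 = x} := by
          apply card_image_of_injOn
          intro a ha b hb hab
          simp only [coe_filter, Set.mem_ofPred_eq] at ha hb
          exact Prod.ext hab (ha.2.trans hb.2.symm)
        rw [← hinj, ← card_union_of_disjoint]
        · apply card_le_card
          intro o ho
          simp only [mem_union, mem_image, mem_filter, mem_insert, hcov, hP'] at ho ⊢
          rcases ho with ⟨e, he, rfl⟩ | ⟨e, he, rfl⟩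
          · exact ⟨e, ⟨he.1, Or.inr he.2⟩, rfl⟩
          · exact ⟨e, ⟨he.1.1, Or.inl he.2⟩, rfl⟩
        · rw [disjoint_right]
          intro o ho
          obtain ⟨e, he, rfl⟩ := mem_image.mp ho
          exact (mem_filter.mp (mem_filter.mp he).1).2
      calc (t + 1) * #P ≤ 2 * #S * #cov + 2 * #P' := by nlinarith
        _ ≤ 2 * #S * #cov + 2 * (#S * #{e ∈ P' | e.2 = x}) := by gcongr
        _ = 2 * #S * (#cov + #{e ∈ P' | e.2 = x}) := by ring
        _ ≤ _ := by gcongr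

/-- The number of neighbours of `v` in `S`. -/
noncomputable def deg {W : Type*} (G : SimpleGraph W) (v : W) (S : Finset W) : ℕ :=
  #{y ∈ S | G.Adj v y}

/-- The restriction of `f` to `R`, as a partial function. -/
def partialRestrict {ι W : Type*} [DecidableEq ι] (R : Finset ι) (f : ι → W) : ι → Option W :=
  fun t => if t ∈ R then some (f t) else none

lemma partialRestrict_insert {ι W : Type*} [DecidableEq ι] (R : Finset ι) (a : ι) (f : ι → W) :
    partialRestrict (insert a R) f = Function.update (partialRestrict R f) a (some (f a)) := by
  funext t
  by_cases h : t = a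
  · subst h; simp [partialRestrict]
  · simp [partialRestrict, h]

lemma eq_of_partialRestrict_eq {ι W : Type*} [DecidableEq ι] {R : Finset ι} {f g : ι → W}
    (h : partialRestrict R f = partialRestrict R g) {t : ι} (ht : t ∈ R) : f t = g t := by
  have := congrFun h t
  simpa [partialRestrict, ht] using this

/-- Given many tuples whose coordinates are joined, along a tree rooted at `w`, by edges of `G`
with bounded degrees, one can choose at most `s` vertices in every coordinate but `w` so that
the tuples using only these vertices have many different values at `w`. -/
lemma exists_cover {ι W : Type*} [Fintype ι] [DecidableEq ι] (G : SimpleGraph W) (A : ι → Finset W)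
    (C : Finset (ι → W)) (hC : ∀ f ∈ C, ∀ a, f a ∈ A a) (w : ι) (rank : ι → ℕ) (q : ι → ι)
    (hrank : ∀ a, a ≠ w → rank (q a) < rank a)
    (hadj : ∀ f ∈ C, ∀ a, a ≠ w → G.Adj (f (q a)) (f a)) (m : ι → ℕ) (s : ℕ)
    (hdeg : ∀ a, a ≠ w → ∀ v ∈ A (q a), deg G v (A a) ≤ m a) (hs : ∀ a, s * m a ≤ #(A a)) :
    ∃ X : ι → Finset W, (∀ a, X a ⊆ A a ∧ #(X a) ≤ s) ∧ ∃ D ⊆ C,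
      (∀ f ∈ D, ∀ a, a ≠ w → f a ∈ X a) ∧
      s ^ #(univ.erase w) * #C ≤
        2 ^ #(univ.erase w) * (∏ a ∈ univ.erase w, #(A a)) * #(D.image (fun f => f w)) := by
  -- `R` is a subtree containing the root. Coordinates outside `R` are already confined to small
  -- sets, and the quantity tracked is the number of distinct restrictions to `R`.
  have key : ∀ n, ∀ R : Finset ι, #Rᶜ = n → w ∈ R → (∀ a ∈ R, a ≠ w → q a ∈ R) →
      ∃ X : ι → Finset W, (∀ a, X a ⊆ A a ∧ #(X a) ≤ s) ∧ ∃ D ⊆ C,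
        (∀ f ∈ D, ∀ a, a ∉ R → f a ∈ X a) ∧
        s ^ n * #C ≤ 2 ^ n * (∏ a ∈ Rᶜ, #(A a)) * #(D.image (partialRestrict R)) := by
    intro n
    induction n with
    | zero =>
      intro R hR _ _
      have hRu : R = univ := by simpa using hR
      refine ⟨fun _ => ∅, by simp, C, subset_rfl, by simp [hRu], ?_⟩
      rw [card_image_of_injective]
      · simp [hRu]
      · intro f g hfg
        funext t
        exact eq_of_partialRestrict_eq hfg (by simp [hRu])
    | succ n ih =>
      intro R hR hwR hcl
      have hne : Rᶜ.Nonempty := card_pos.mp (by omega)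
      -- Minimal rank outside `R` puts the parent `q a` in `R`. A restriction to `R` thus fixes `f
      -- (q a)`, which leaves at most `m a` choices for `f a`, as the greedy cover requires.
      obtain ⟨a, haR, hmin⟩ := exists_min_image Rᶜ rank hne
      have haR' : a ∉ R := by simpa using haR
      have haw : a ≠ w := fun h => haR' (h ▸ hwR)
      have hqa : q a ∈ R := by
        by_contra hq
        have := hmin (q a) (by simpa using hq)
        have := hrank a haw
        omega
      have hcompl : Rᶜ = insert a (insert a R)ᶜ := by
        ext t; simp only [mem_compl, mem_insert]; by_cases h : t = a <;> simp [h, haR']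
      have hanot : a ∉ (insert a R)ᶜ := by simp
      obtain ⟨X, hX, D, hDC, hDX, hD⟩ := ih (insert a R)
        (by rw [hcompl, card_insert_of_notMem hanot] at hR; omega)
        (mem_insert_of_mem hwR) (by
          intro b hb hbw
          rcases mem_insert.mp hb with rfl | hb
          · exact mem_insert_of_mem hqa
          · exact mem_insert_of_mem (hcl b hb hbw))
      set P : Finset ((ι → Option W) × W) :=
        D.image (fun f => (partialRestrict R f, f a)) with hP
      have hPcard : #(D.image (partialRestrict (insert a R))) ≤ #P := by
        have : D.image (partialRestrict (insert a R)) =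
            P.image (fun e => Function.update e.1 a (some e.2)) := by
          rw [hP, image_image]
          apply image_congr
          intro f _
          exact partialRestrict_insert R a f
        rw [this]
        exact card_image_le
      obtain ⟨Y, hYA, hYs, hY⟩ := exists_greedy_cover P (A a)
        (by
          intro e he
          obtain ⟨f, hf, rfl⟩ := mem_image.mp he
          exact hC f (hDC hf) a) (m a) s
        (by
          intro o
          rcases ({e ∈ P | e.1 = o}).eq_empty_or_nonempty with h0 | ⟨e, he⟩
          · simp [h0]
          · obtain ⟨heP, heo⟩ := mem_filter.mp he
            obtain ⟨f, hf, rfl⟩ := mem_image.mp heP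
            refine le_trans ?_ (hdeg a haw (f (q a)) (hC f (hDC hf) (q a)))
            apply card_le_card_of_injOn Prod.snd
            · intro e' he'
              obtain ⟨he'P, he'o⟩ := mem_filter.mp (mem_coe.mp he')
              obtain ⟨g, hg, rfl⟩ := mem_image.mp he'P
              have hfg : f (q a) = g (q a) :=
                eq_of_partialRestrict_eq (heo.trans he'o.symm) hqa
              simp only [coe_filter, Set.mem_ofPred_eq]
              exact ⟨hC g (hDC hg) a, hfg ▸ hadj g (hDC hg) a haw⟩
            · intro e1 h1 e2 h2 h12
              exact Prod.ext ((mem_filter.mp (mem_coe.mp h1)).2.trans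
                (mem_filter.mp (mem_coe.mp h2)).2.symm) h12)
        (hs a)
      refine ⟨Function.update X a Y, ?_, {f ∈ D | f a ∈ Y}, (filter_subset _ _).trans hDC, ?_, ?_⟩
      · intro b
        by_cases hb : b = a
        · subst hb; simpa using ⟨hYA, hYs⟩
        · simpa [hb] using hX b
      · intro f hf b hb
        obtain ⟨hfD, hfY⟩ := mem_filter.mp hf
        by_cases hba : b = a
        · subst hba; simpa using hfY
        · simpa [hba] using hDX f hfD b (by simp [hba, hb])
      · have himg : {e ∈ P | e.2 ∈ Y}.image Prod.fst =
            {f ∈ D | f a ∈ Y}.image (partialRestrict R) := by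
          ext o
          simp only [hP, mem_image, mem_filter]
          constructor
          · rintro ⟨e, ⟨⟨f, hf, rfl⟩, he⟩, rfl⟩; exact ⟨f, ⟨hf, he⟩, rfl⟩
          · rintro ⟨f, ⟨hf, he⟩, rfl⟩; exact ⟨_, ⟨⟨f, hf, rfl⟩, he⟩, rfl⟩
        rw [himg] at hY
        rw [hcompl, prod_insert hanot]
        calc s ^ (n + 1) * #C = s * (s ^ n * #C) := by ring
          _ ≤ s * (2 ^ n * (∏ a ∈ (insert a R)ᶜ, #(A a)) *
              #(D.image (partialRestrict (insert a R)))) := by gcongr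
          _ ≤ s * (2 ^ n * (∏ a ∈ (insert a R)ᶜ, #(A a)) * #P) := by gcongr
          _ = 2 ^ n * (∏ a ∈ (insert a R)ᶜ, #(A a)) * (s * #P) := by ring
          _ ≤ 2 ^ n * (∏ a ∈ (insert a R)ᶜ, #(A a)) * (2 * #(A a) * _) :=
              Nat.mul_le_mul_left _ hY
          _ = _ := by ring
  obtain ⟨X, hX, D, hDC, hDX, hD⟩ := key _ {w} rfl (by simp) (by simp)
  refine ⟨X, hX, D, hDC, fun f hf a ha => hDX f hf a (by simpa using ha), ?_⟩
  have hcompl : ({w} : Finset ι)ᶜ = univ.erase w := by ext; simp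
  rw [hcompl] at hD
  refine hD.trans (Nat.mul_le_mul_left _ ?_)
  have : D.image (partialRestrict {w}) =
      (D.image (fun f => f w)).image
        (fun v => fun t => if t ∈ ({w} : Finset ι) then some v else none) := by
    rw [image_image]
    apply image_congr
    intro f _
    funext t
    by_cases h : t = w <;> simp [partialRestrict, h]
  rw [this]
  exact card_image_le

/-! ### Forests as parent functions -/

/-- Every nonempty set of vertices of an acyclic graph contains a vertex with at most one
neighbour in the set. -/
lemma exists_mem_subsingleton_nbrs {V : Type*} {T : SimpleGraph V} (hT : T.IsAcyclic)
    (S : Finset V) (hS : S.Nonempty) :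
    ∃ v ∈ S, ∀ x ∈ S, ∀ y ∈ S, T.Adj v x → T.Adj v y → x = y := by
  have hH := hT.induce (S : Set V)
  have : Nonempty (S : Set V) := hS.to_subtype
  -- The end of a longest path works: another neighbour would extend the path or close a cycle.
  obtain ⟨u, v, p, hp, hmax⟩ :=
    SimpleGraph.Walk.exists_isPath_forall_isPath_length_le_length (T.induce (S : Set V))
  have huniq : ∀ w, (T.induce (S : Set V)).Adj v w → w = p.penultimate := by
    intro w hadj
    apply hH.eq_penultimate_of_adj_end hp hadj
    by_contra hw
    have := hmax _ _ (p.concat hadj) (hp.concat hw hadj)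
    simp at this
  refine ⟨v, v.2, fun x hx y hy hvx hvy => ?_⟩
  have h1 := huniq ⟨x, hx⟩ hvx
  have h2 := huniq ⟨y, hy⟩ hvy
  exact congrArg Subtype.val (h1.trans h2.symm)

/-- An acyclic graph is an induced subgraph of a tree on `ℕ` given by a parent function. -/
lemma exists_parent {V : Type*} {T : SimpleGraph V} (hT : T.IsAcyclic) (n : ℕ) :
    ∀ S : Finset V, #S = n → ∃ (e : V → ℕ) (p : ℕ → ℕ), (∀ v ∈ S, 1 ≤ e v ∧ e v ≤ n) ∧
      (∀ u ∈ S, ∀ v ∈ S, e u = e v → u = v) ∧ p 0 = 0 ∧ (∀ a, 1 ≤ a → p a < a) ∧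
      ∀ u ∈ S, ∀ v ∈ S, T.Adj u v ↔ (p (e u) = e v ∨ p (e v) = e u) := by
  induction n with
  | zero =>
    intro S hS
    rw [card_eq_zero] at hS
    subst hS
    exact ⟨fun _ => 0, fun _ => 0, by simp, by simp, rfl, fun a ha => ha, by simp⟩
  | succ n ih =>
    intro S hS
    obtain ⟨v, hv, hvu⟩ := exists_mem_subsingleton_nbrs hT S (card_pos.mp (by omega))
    obtain ⟨e, p, he, hinj, hp0, hp, hadj⟩ := ih (S.erase v) (by rw [card_erase_of_mem hv]; omega)
    obtain ⟨z, hz, hzadj⟩ : ∃ z, z ≤ n ∧ ∀ u ∈ S.erase v, T.Adj v u ↔ z = e u := by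
      by_cases h : ∃ u ∈ S.erase v, T.Adj v u
      · obtain ⟨u₀, hu₀, hvu₀⟩ := h
        refine ⟨e u₀, (he u₀ hu₀).2, fun u hu => ⟨fun h => ?_, fun h => ?_⟩⟩
        · rw [hvu u₀ (mem_of_mem_erase hu₀) u (mem_of_mem_erase hu) hvu₀ h]
        · rwa [← hinj u₀ hu₀ u hu h]
      -- A vertex without earlier neighbours hangs from the extra vertex `0`, which encodes no
      -- vertex of the forest. This joins the components without adding adjacencies among encoded
      -- vertices.
      · refine ⟨0, by omega, fun u hu => ⟨fun h' => absurd ⟨u, hu, h'⟩ h, fun h' => ?_⟩⟩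
        have := (he u hu).1
        omega
    have hval : ∀ u ∈ S, u ≠ v → Function.update e v (n + 1) u = e u ∧ e u ≤ n ∧ 1 ≤ e u ∧
        Function.update p (n + 1) z (e u) = p (e u) ∧ p (e u) < e u := by
      intro u hu huv
      have := he u (mem_erase.mpr ⟨huv, hu⟩)
      refine ⟨by simp [huv], this.2, this.1, ?_, hp _ this.1⟩
      rw [Function.update_of_ne]; omega
    refine ⟨Function.update e v (n + 1), Function.update p (n + 1) z, ?_, ?_, ?_, ?_, ?_⟩
    · intro u hu
      by_cases huv : u = v
      · subst huv; simp
      · have := hval u hu huv; omega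
    · intro x hx y hy hxy
      by_cases hxv : x = v <;> by_cases hyv : y = v
      · rw [hxv, hyv]
      · subst hxv; have := hval y hy hyv; simp at hxy; omega
      · subst hyv; have := hval x hx hxv; simp at hxy; omega
      · rw [(hval x hx hxv).1, (hval y hy hyv).1] at hxy
        exact hinj x (mem_erase.mpr ⟨hxv, hx⟩) y (mem_erase.mpr ⟨hyv, hy⟩) hxy
    · simpa using hp0
    · intro a ha
      by_cases han : a = n + 1
      · subst han; simp; omega
      · simpa [han] using hp a ha
    · intro x hx y hy
      by_cases hxv : x = v <;> by_cases hyv : y = v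
      · subst hxv; subst hyv
        simp; omega
      · subst hxv
        have h1 := hval y hy hyv
        rw [h1.1, h1.2.2.2.1, hzadj y (mem_erase.mpr ⟨hyv, hy⟩)]
        simp; omega
      · subst hyv
        have h1 := hval x hx hxv
        rw [h1.1, h1.2.2.2.1, T.adj_comm, hzadj x (mem_erase.mpr ⟨hxv, hx⟩)]
        simp; omega
      · have h1 := hval x hx hxv
        have h2 := hval y hy hyv
        rw [h1.1, h2.1, h1.2.2.2.1, h2.2.2.2.1]
        exact hadj x (mem_erase.mpr ⟨hxv, hx⟩) y (mem_erase.mpr ⟨hyv, hy⟩)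

/-- The tree on `{0, …, n}` given by a parent function can be rooted at any vertex `w`. -/
lemma exists_rerooting {p : ℕ → ℕ} (hp : ∀ a, 1 ≤ a → p a < a) (n : ℕ) :
    ∀ w ≤ n, ∃ rank q : ℕ → ℕ, ∀ a ≤ n, a ≠ w →
      q a ≤ n ∧ rank (q a) < rank a ∧ (p a = q a ∨ p (q a) = a) ∧ q a ≠ a := by
  induction n with
  | zero => intro w hw; exact ⟨id, id, fun a ha haw => by omega⟩
  | succ n ih =>
    have hpn := hp (n + 1) (by omega)
    intro w hw
    by_cases hwn : w = n + 1
    · obtain ⟨rank, q, h⟩ := ih (p (n + 1)) (by omega)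
      refine ⟨fun a => if a = n + 1 then 0 else rank a + 1,
        fun a => if a = p (n + 1) then n + 1 else q a, fun a ha haw => ?_⟩
      by_cases hap : a = p (n + 1)
      · have h1 : p (n + 1) ≠ n + 1 := by omega
        simp [hap, h1]; omega
      · have := h a (by omega) hap
        have h1 : q a ≠ n + 1 := by omega
        have h2 : a ≠ n + 1 := by omega
        simp only [hap, h1, h2, if_false]
        omega
    · obtain ⟨rank, q, h⟩ := ih w (by omega)
      refine ⟨Function.update rank (n + 1) (rank (p (n + 1)) + 1),
        Function.update q (n + 1) (p (n + 1)), fun a ha haw => ?_⟩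
      by_cases han : a = n + 1
      · subst han
        have h1 : p (n + 1) ≠ n + 1 := by omega
        simp [h1]; omega
      · have := h a (by omega) haw
        have h1 : q a ≠ n + 1 := by omega
        simp only [Function.update_of_ne han, Function.update_of_ne h1]
        omega

/-! ### Copies of the tree and their extensions -/

variable {W : Type*} (G : SimpleGraph W) (p : ℕ → ℕ)

/-- `f` embeds the tree on `{0, …, n - 1}` with parent function `p` as an induced subgraph. -/
def IsCopy {n : ℕ} (f : Fin n → W) : Prop :=
  ∀ a b : Fin n, a ≠ b → (G.Adj (f a) (f b) ↔ (p a = b ∨ p b = a))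

/-- The copies of the tree on `{0, …, n - 1}` whose `a`-th vertex is in the block `A (τ a)`. -/
noncomputable def copies (n : ℕ) (A : ℕ → Finset W) (τ : ℕ → ℕ) : Finset (Fin n → W) :=
  {f ∈ Fintype.piFinset (fun a : Fin n => A (τ a)) | IsCopy G p f}

variable {G p}

lemma mem_copies {n : ℕ} {A : ℕ → Finset W} {τ : ℕ → ℕ} {f : Fin n → W} :
    f ∈ copies G p n A τ ↔ (∀ a : Fin n, f a ∈ A (τ a)) ∧ IsCopy G p f := by
  simp [copies]

lemma copies_congr {n : ℕ} {A A' : ℕ → Finset W} {τ τ' : ℕ → ℕ}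
    (h : ∀ a < n, A (τ a) = A' (τ' a)) : copies G p n A τ = copies G p n A' τ' := by
  ext f
  simp only [mem_copies]
  exact and_congr_left fun _ => forall_congr' fun a => by rw [h a a.2]

lemma copies_mono {n : ℕ} {A A' : ℕ → Finset W} {τ : ℕ → ℕ}
    (h : ∀ a < n, A (τ a) ⊆ A' (τ a)) : copies G p n A τ ⊆ copies G p n A' τ := by
  intro f hf
  rw [mem_copies] at hf ⊢
  exact ⟨fun a => h a a.2 (hf.1 a), hf.2⟩

lemma isCopy_snoc (hp : ∀ a, 1 ≤ a → p a < a) (hp0 : p 0 = 0) {n : ℕ} {f : Fin n → W}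
    (hf : IsCopy G p f) {y : W} (hy : ∀ a : Fin n, G.Adj (f a) y ↔ p n = a) :
    IsCopy G p (Fin.snoc f y : Fin (n + 1) → W) := by
  have hlt : ∀ a : Fin n, p a ≠ n := by
    intro a
    rcases Nat.eq_zero_or_pos (a : ℕ) with h | h
    · rw [h, hp0]; omega
    · have := hp a h; omega
  intro a b hab
  induction a using Fin.lastCases with
  | last =>
    induction b using Fin.lastCases with
    | last => exact absurd rfl hab
    | cast b =>
      simp only [Fin.snoc_last, Fin.snoc_castSucc, Fin.val_last, Fin.val_castSucc]
      rw [G.adj_comm, hy b]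
      simp [hlt b]
  | cast a =>
    induction b using Fin.lastCases with
    | last =>
      simp only [Fin.snoc_last, Fin.snoc_castSucc, Fin.val_last, Fin.val_castSucc]
      rw [hy a]
      simp [hlt a]
    | cast b =>
      simp only [Fin.snoc_castSucc, Fin.val_castSucc]
      exact hf a b (fun h => hab (by rw [h]))

/-- The vertices of `Y` which extend the copy `f` by one more vertex. -/
noncomputable def extensions (G : SimpleGraph W) (p : ℕ → ℕ) {n : ℕ} (f : Fin n → W)
    (Y : Finset W) : Finset W :=
  {y ∈ Y | IsCopy G p (Fin.snoc f y : Fin (n + 1) → W)}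

lemma sum_card_extensions_le {n : ℕ} (A : ℕ → Finset W) (τ : ℕ → ℕ) :
    ∑ f ∈ copies G p n A τ, #(extensions G p f (A (τ n))) ≤ #(copies G p (n + 1) A τ) := by
  rw [← card_sigma]
  apply card_le_card_of_injOn (fun e => (Fin.snoc e.1 e.2 : Fin (n + 1) → W))
  · intro e he
    simp only [coe_sigma, Set.mem_sigma_iff, mem_coe, extensions, mem_filter, mem_copies] at he
    simp only [mem_coe, mem_copies]
    refine ⟨fun a => ?_, he.2.2⟩
    induction a using Fin.lastCases with
    | last => simpa using he.2.1
    | cast a => simpa using he.1.1 a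
  · rintro ⟨f, y⟩ _ ⟨g, z⟩ _ h
    have h' := Fin.snoc_injective2 h
    exact Sigma.ext h'.1 (heq_of_eq h'.2)

/-- Block by block, `A'` is a subset of `A` and makes up at least a `κ`-fraction of it. -/
def IsFraction (κ : ℝ) (A A' : ℕ → Finset W) : Prop :=
  ∀ x, A' x ⊆ A x ∧ κ * #(A x) ≤ #(A' x)

/-- Every family of `κ`-fractions of the blocks `A (τ a)` contains at least a `1 / E`-fraction
of the largest conceivable number of copies of the tree on `{0, …, i}`, when degrees between
blocks have density at most `Δ`. -/
def IsRich (G : SimpleGraph W) (p : ℕ → ℕ) (i : ℕ) (A : ℕ → Finset W) (τ : ℕ → ℕ)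
    (Δ E κ : ℝ) : Prop :=
  ∀ A', IsFraction κ A A' →
    Δ ^ i * ∏ a ∈ range (i + 1), (#(A' (τ a)) : ℝ) ≤ E * #(copies G p (i + 1) A' τ)

/-- The vertices of `Y` with a neighbour in `U`. -/
noncomputable def nbrsIn (G : SimpleGraph W) (U Y : Finset W) : Finset W :=
  {z ∈ Y | ∃ u ∈ U, G.Adj u z}

/-- The new leaf must be adjacent to `f w` and to nothing else in the copy. All other vertices of
the copy lie in `U`, so avoiding the neighbours of `U` rules out every unwanted adjacency at once.
-/
lemma IsCopy.mem_extensions {n : ℕ} {f : Fin n → W} (hf : IsCopy G p f)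
    (hp : ∀ a, 1 ≤ a → p a < a) (hp0 : p 0 = 0) (w : Fin n) (hw : p n = w) {U Y : Finset W}
    (hU : ∀ a, a ≠ w → f a ∈ U) {z : W} (hz : z ∈ Y) (hadj : G.Adj (f w) z)
    (hzU : z ∉ nbrsIn G U Y) : z ∈ extensions G p f Y := by
  simp only [extensions, mem_filter]
  refine ⟨hz, isCopy_snoc hp hp0 hf fun a => ?_⟩
  by_cases ha : a = w
  · subst ha; simp [hw, hadj]
  · have h1 : ¬ G.Adj (f a) z := fun h => hzU (by
      simp only [nbrsIn, mem_filter]; exact ⟨hz, f a, hU a ha, h⟩)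
    simp only [h1, hw, false_iff]
    exact fun h => ha (Fin.ext h.symm)

lemma card_nbrsIn_le {U Y : Finset W} {D : ℝ} (hD : ∀ u ∈ U, (deg G u Y : ℝ) ≤ D) :
    (#(nbrsIn G U Y) : ℝ) ≤ #U * D := by
  have h1 : nbrsIn G U Y ⊆ U.biUnion (fun u => {y ∈ Y | G.Adj u y}) := by
    intro z hz
    simp only [nbrsIn, mem_filter] at hz
    obtain ⟨hz, u, hu, huz⟩ := hz
    simp only [mem_biUnion, mem_filter]
    exact ⟨u, hu, hz, huz⟩
  calc (#(nbrsIn G U Y) : ℝ) ≤ ((∑ u ∈ U, deg G u Y : ℕ) : ℝ) := by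
        exact_mod_cast (card_le_card h1).trans card_biUnion_le
    _ = ∑ u ∈ U, (deg G u Y : ℝ) := by push_cast; rfl
    _ ≤ ∑ u ∈ U, D := sum_le_sum hD
    _ = #U * D := by simp

/-! ### From missing extensions to sparse pairs -/

/-- If few copies of the tree on `{0, …, i}` extend to the next vertex in a block of `Y`, then
few copies have many extensions. -/
lemma card_filter_extensions_le {i : ℕ} {A : ℕ → Finset W} {τ : ℕ → ℕ} {Y : Finset ℕ} {q : ℕ}
    {Δ E E' K : ℝ} (hΔ : 0 < Δ) (hE : 0 < E) (hK : 0 < K) (hE' : 0 ≤ E')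
    (hYq : #Y ≤ q) (hA : ∀ y ∈ Y, (A y).Nonempty)
    (hlow : ∀ y ∈ Y, E' * #(copies G p (i + 2) A (Function.update τ (i + 1) y)) ≤
      K * (Δ ^ (i + 1) * ((∏ a ∈ range (i + 1), (#(A (τ a)) : ℝ)) * #(A y)))) :
    4 * E * #{f ∈ copies G p (i + 1) A τ |
      ∃ y ∈ Y, 4 * q * K * E * Δ * #(A y) < E' * #(extensions G p f (A y))} ≤
      Δ ^ i * ∏ a ∈ range (i + 1), (#(A (τ a)) : ℝ) := by
  set P := ∏ a ∈ range (i + 1), (#(A (τ a)) : ℝ) with hP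
  have hP0 : 0 ≤ P := prod_nonneg fun _ _ => by positivity
  clear_value P
  rcases Nat.eq_zero_or_pos q with hq | hq
  · have : Y = ∅ := by rw [← card_eq_zero]; omega
    simpa [this] using mul_nonneg (pow_nonneg hΔ.le i) hP0
  have hq' : (0 : ℝ) < q := by exact_mod_cast hq
  set bad : ℕ → Finset (Fin (i + 1) → W) := fun y => {f ∈ copies G p (i + 1) A τ |
      4 * q * K * E * Δ * #(A y) < E' * #(extensions G p f (A y))} with hbad
  -- Markov's inequality: each bad copy contributes many copies of the larger tree, which are few by
  -- `hlow`. Every `y` receives a share `1 / q` of the allowance, and there are at most `q` of them.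
  have h1 : ∀ y ∈ Y, 4 * E * #(bad y) * q ≤ Δ ^ i * P := by
    intro y hy
    have hAy : (0 : ℝ) < #(A y) := by exact_mod_cast card_pos.mpr (hA y hy)
    have hc : copies G p (i + 1) A (Function.update τ (i + 1) y) = copies G p (i + 1) A τ :=
      copies_congr fun a ha => by rw [Function.update_of_ne (by omega)]
    have h2 := sum_card_extensions_le (G := G) (p := p) (n := i + 1) A
      (Function.update τ (i + 1) y)
    rw [hc, Function.update_self] at h2
    have h2' : ∑ f ∈ copies G p (i + 1) A τ, (#(extensions G p f (A y)) : ℝ) ≤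
        #(copies G p (i + 2) A (Function.update τ (i + 1) y)) := by exact_mod_cast h2
    have h3 : #(bad y) * (4 * q * K * E * Δ * #(A y)) ≤
        E' * ∑ f ∈ copies G p (i + 1) A τ, (#(extensions G p f (A y)) : ℝ) := by
      calc #(bad y) * (4 * q * K * E * Δ * #(A y))
          = ∑ f ∈ bad y, (4 * q * K * E * Δ * #(A y)) := by simp
        _ ≤ ∑ f ∈ bad y, E' * (#(extensions G p f (A y)) : ℝ) :=
            sum_le_sum fun f hf => (mem_filter.mp hf).2.le
        _ ≤ ∑ f ∈ copies G p (i + 1) A τ, E' * (#(extensions G p f (A y)) : ℝ) :=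
            sum_le_sum_of_subset_of_nonneg (filter_subset _ _) fun _ _ _ => by positivity
        _ = _ := by rw [mul_sum]
    have h4 := h3.trans ((mul_le_mul_of_nonneg_left h2' hE').trans (hlow y hy))
    have h5 : (4 * E * #(bad y) * q) * (K * Δ * #(A y)) ≤ (Δ ^ i * P) * (K * Δ * #(A y)) := by
      calc _ = #(bad y) * (4 * q * K * E * Δ * #(A y)) := by ring
        _ ≤ _ := h4
        _ = _ := by ring
    exact le_of_mul_le_mul_right h5 (by positivity)
  have h6 : #{f ∈ copies G p (i + 1) A τ |
      ∃ y ∈ Y, 4 * q * K * E * Δ * #(A y) < E' * #(extensions G p f (A y))} ≤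
      ∑ y ∈ Y, #(bad y) := by
    refine le_trans (card_le_card ?_) card_biUnion_le
    intro f hf
    obtain ⟨hf, y, hy, h⟩ := mem_filter.mp hf
    exact mem_biUnion.mpr ⟨y, hy, mem_filter.mpr ⟨hf, h⟩⟩
  have h7 : (∑ y ∈ Y, 4 * E * (#(bad y) : ℝ) * q) ≤ #Y * (Δ ^ i * P) := by
    calc _ ≤ ∑ y ∈ Y, Δ ^ i * P := sum_le_sum h1
      _ = _ := by simp
  have h8 : (∑ y ∈ Y, 4 * E * (#(bad y) : ℝ) * q) = 4 * E * (∑ y ∈ Y, (#(bad y) : ℝ)) * q := by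
    rw [mul_sum, sum_mul]
  have h9 : 4 * E * (∑ y ∈ Y, (#(bad y) : ℝ)) * q ≤ (Δ ^ i * P) * q := by
    rw [← h8]
    refine h7.trans ?_
    rw [mul_comm _ (q : ℝ)]
    have : (#Y : ℝ) ≤ q := by exact_mod_cast hYq
    exact mul_le_mul_of_nonneg_right this (mul_nonneg (pow_nonneg hΔ.le i) hP0)
  refine le_trans ?_ (le_of_mul_le_mul_right h9 hq')
  have : (#{f ∈ copies G p (i + 1) A τ |
      ∃ y ∈ Y, 4 * q * K * E * Δ * #(A y) < E' * #(extensions G p f (A y))} : ℝ) ≤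
      ∑ y ∈ Y, (#(bad y) : ℝ) := by exact_mod_cast h6
  exact mul_le_mul_of_nonneg_left this (by positivity)

/-- If copies of the tree on `{0, …, i}` are abundant in the blocks `A (τ a)`, but hardly ever
extend to a copy of the tree on `{0, …, i + 1}` with the new vertex in a block of `Y`, then a
large part `B` of the block `A (τ w)`, where `w` is the parent of `i + 1`, has few edges to the
blocks of `Y` once the neighbours of a small set `U` are removed. -/
lemma exists_sparse_part (hp : ∀ a, 1 ≤ a → p a < a) (hp0 : p 0 = 0) {i : ℕ}
    {A : ℕ → Finset W} {τ : ℕ → ℕ} {N : ℕ → ℝ} {Y : Finset ℕ} {q : ℕ}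
    {Δ E E' K δ l : ℝ} (hΔ : 0 < Δ) (hE : 0 < E) (hK : 0 < K) (hE' : 0 ≤ E')
    (hYq : #Y ≤ q) (hA : ∀ y, (A y).Nonempty) (hN : ∀ x, 0 ≤ N x) (hNA : ∀ x, l * N x ≤ #(A x))
    (hδl : δ ≤ l) (hΔδ : Δ ≤ δ)
    (hdeg : ∀ a ≤ i, ∀ b ≤ i, a ≠ b → ∀ v ∈ A (τ b), (deg G v (A (τ a)) : ℝ) ≤ Δ * N (τ a))
    (hdegY : ∀ y ∈ Y, ∀ b ≤ i, ∀ v ∈ A (τ b), (deg G v (A y) : ℝ) ≤ Δ * N y)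
    (hlow : ∀ y ∈ Y, E' * #(copies G p (i + 2) A (Function.update τ (i + 1) y)) ≤
      K * (Δ ^ (i + 1) * ((∏ a ∈ range (i + 1), (#(A (τ a)) : ℝ)) * #(A y))))
    {Z : Finset W}
    (hZ : Δ ^ i * ∏ a ∈ range (i + 1), (#(A (τ a)) : ℝ) ≤
      2 * E * #{f ∈ copies G p (i + 1) A τ | f ⟨p (i + 1), hp _ (by omega)⟩ ∈ Z}) :
    ∃ U B : Finset W, B ⊆ Z ∧ B ⊆ A (τ (p (i + 1))) ∧
      (δ / 4) ^ i * #(A (τ (p (i + 1)))) ≤ 4 * E * #B ∧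
      (∀ y ∈ Y, (#(nbrsIn G U (A y)) : ℝ) ≤ i * δ * N y) ∧
      ∀ b ∈ B, ∀ y ∈ Y,
        E' * deg G b (A y \ nbrsIn G U (A y)) ≤ 4 * q * K * E * Δ * #(A y) := by
  set w : Fin (i + 1) := ⟨p (i + 1), hp _ (by omega)⟩ with hw
  set P := ∏ a ∈ range (i + 1), (#(A (τ a)) : ℝ) with hP
  have hδ : 0 < δ := hΔ.trans_le hΔδ
  have hApos : ∀ x, (0 : ℝ) < #(A x) := fun x => by exact_mod_cast card_pos.mpr (hA x)
  have hP0 : 0 < P := prod_pos fun a _ => hApos (τ a)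
  have hbad := card_filter_extensions_le (G := G) (p := p) hΔ hE hK hE' hYq
    (fun y _ => hA y) hlow
  rw [← hP] at hbad
  clear_value P
  set C := {f ∈ copies G p (i + 1) A τ | f w ∈ Z ∧
    ∀ y ∈ Y, E' * #(extensions G p f (A y)) ≤ 4 * q * K * E * Δ * #(A y)} with hC
  -- Copies through `Z` make up at least `1 / (2 * E)` of the benchmark and bad ones at most `1 / (4
  -- * E)`.
  have hCcard : Δ ^ i * P ≤ 4 * E * #C := by
    set bad := {f ∈ copies G p (i + 1) A τ |
      ∃ y ∈ Y, 4 * q * K * E * Δ * #(A y) < E' * #(extensions G p f (A y))}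
    have h1 : {f ∈ copies G p (i + 1) A τ | f w ∈ Z} ⊆ C ∪ bad := by
      intro f hf
      obtain ⟨hf, hfZ⟩ := mem_filter.mp hf
      by_cases h : ∃ y ∈ Y, 4 * q * K * E * Δ * #(A y) < E' * #(extensions G p f (A y))
      · exact mem_union_right _ (mem_filter.mpr ⟨hf, h⟩)
      · push Not at h
        exact mem_union_left _ (mem_filter.mpr ⟨hf, hfZ, h⟩)
    have h2 : (#{f ∈ copies G p (i + 1) A τ | f w ∈ Z} : ℝ) ≤ #C + #bad := by
      exact_mod_cast (card_le_card h1).trans (card_union_le _ _)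
    have h3 := mul_le_mul_of_nonneg_left h2 (by positivity : 0 ≤ 2 * E)
    linarith
  obtain ⟨rank, par, hpar⟩ := exists_rerooting hp i w (by omega)
  -- The largest `s` with `s * Δ ≤ δ`: selected vertices, `s` per block, then see at most `i * δ * N
  -- y` of a block of `Y`. Rounding down costs at most a factor 2, which with the factor 2 per
  -- coordinate of the cover gives `(δ / 4) ^ i`.
  set s := ⌊δ / Δ⌋₊ with hs
  have hs1 : 1 ≤ s := by
    rw [hs, Nat.one_le_floor_iff, le_div_iff₀ hΔ]; simpa using hΔδ
  have hsΔ : s * Δ ≤ δ := by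
    have := Nat.floor_le (by positivity : 0 ≤ δ / Δ)
    rwa [le_div_iff₀ hΔ] at this
  have hsΔ' : δ / 2 ≤ s * Δ := by
    have h1 := Nat.lt_floor_add_one (δ / Δ)
    rw [div_lt_iff₀ hΔ] at h1
    have h2 : (1 : ℝ) ≤ s := by exact_mod_cast hs1
    nlinarith
  -- The default `a` can only be taken at the root `w`, where no parent is needed.
  let par' : Fin (i + 1) → Fin (i + 1) := fun a =>
    if h : par a ≤ i then ⟨par a, by omega⟩ else a
  have hpar' : ∀ a : Fin (i + 1), a ≠ w → (par' a : ℕ) = par a := by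
    intro a ha
    have := (hpar a (by omega) (fun h => ha (Fin.ext h))).1
    simp [par', this]
  have hpar2 : ∀ a : Fin (i + 1), a ≠ w → rank (par' a) < rank a ∧
      (p a = par' a ∨ p (par' a) = a) ∧ par' a ≠ a := by
    intro a ha
    have := (hpar a (by omega) (fun h => ha (Fin.ext h))).2
    rw [hpar' a ha]
    exact ⟨this.1, this.2.1, fun h => this.2.2 (by rw [← hpar' a ha, h])⟩
  obtain ⟨X, hX, D, hDC, hDX, hD⟩ := exists_cover G (fun a : Fin (i + 1) => A (τ a)) C
    (fun f hf a => (mem_copies.mp (mem_filter.mp hf).1).1 a) w (fun a => rank a) par'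
    (fun a ha => (hpar2 a ha).1)
    (fun f hf a ha => by
      have h := hpar2 a ha
      exact ((mem_copies.mp (mem_filter.mp hf).1).2 _ _ h.2.2).mpr h.2.1.symm)
    (fun a => ⌊Δ * N (τ a)⌋₊) s
    (fun a ha v hv => Nat.le_floor (hdeg a (by omega) (par' a) (by omega)
      (fun h => (hpar2 a ha).2.2 (Fin.ext h.symm)) v hv))
    (fun a => by
      have h1 := Nat.floor_le (mul_nonneg hΔ.le (hN (τ a)))
      have h2 : ((s * ⌊Δ * N (τ a)⌋₊ : ℕ) : ℝ) ≤ #(A (τ a)) := by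
        push_cast
        calc (s : ℝ) * ⌊Δ * N (τ a)⌋₊ ≤ s * (Δ * N (τ a)) := by gcongr
          _ = (s * Δ) * N (τ a) := by ring
          _ ≤ l * N (τ a) := by gcongr; exacts [hN _, hsΔ.trans hδl]
          _ ≤ _ := hNA _
      exact_mod_cast h2)
  refine ⟨(univ.erase w).biUnion X, D.image (fun f => f w), ?_, ?_, ?_, ?_, ?_⟩
  · intro b hb
    obtain ⟨f, hf, rfl⟩ := mem_image.mp hb
    exact (mem_filter.mp (hDC hf)).2.1
  · intro b hb
    obtain ⟨f, hf, rfl⟩ := mem_image.mp hb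
    exact (mem_copies.mp (mem_filter.mp (hDC hf)).1).1 w
  · have hcard : #((univ : Finset (Fin (i + 1))).erase w) = i := by
      rw [card_erase_of_mem (mem_univ _)]; simp
    rw [hcard] at hD
    have hD' : (s : ℝ) ^ i * #C ≤ 2 ^ i * (∏ a ∈ univ.erase w, (#(A (τ a)) : ℝ)) *
        #(D.image (fun f => f w)) := by exact_mod_cast hD
    have hPQ : P = (#(A (τ (p (i + 1)))) : ℝ) * ∏ a ∈ univ.erase w, (#(A (τ a)) : ℝ) := by
      rw [hP, prod_range, ← mul_prod_erase univ _ (mem_univ w)]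
    set Q := ∏ a ∈ univ.erase w, (#(A (τ a)) : ℝ) with hQ
    have hQ0 : 0 < Q := prod_pos fun a _ => hApos (τ a)
    clear_value Q
    have hmain : ((δ / 4) ^ i * #(A (τ (p (i + 1))))) * (2 ^ i * Q) ≤
        (4 * E * #(D.image (fun f => f w))) * (2 ^ i * Q) := by
      calc _ = (δ / 2) ^ i * P := by
            rw [hPQ, show δ / 2 = δ / 4 * 2 by ring, mul_pow]; ring
        _ ≤ (s * Δ) ^ i * P := by
            gcongr
        _ = s ^ i * (Δ ^ i * P) := by ring
        _ ≤ s ^ i * (4 * E * #C) := by gcongr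
        _ = 4 * E * (s ^ i * #C) := by ring
        _ ≤ 4 * E * (2 ^ i * Q * #(D.image (fun f => f w))) := by gcongr
        _ = _ := by ring
    exact le_of_mul_le_mul_right hmain (by positivity)
  · intro y hy
    have h1 : (#((univ.erase w).biUnion X) : ℝ) ≤ i * s := by
      have h := card_biUnion_le_card_mul (univ.erase w) X s (fun a _ => (hX a).2)
      rw [card_erase_of_mem (mem_univ _), card_univ, Fintype.card_fin, Nat.add_sub_cancel] at h
      exact_mod_cast h
    refine (card_nbrsIn_le (D := Δ * N y) ?_).trans ?_
    · intro u hu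
      obtain ⟨a, _, hua⟩ := mem_biUnion.mp hu
      exact hdegY y hy a (by omega) u ((hX a).1 hua)
    · have := hN y
      calc _ ≤ (i * s) * (Δ * N y) := by gcongr
        _ = i * (s * Δ) * N y := by ring
        _ ≤ _ := by gcongr
  · intro b hb y hy
    obtain ⟨f, hf, rfl⟩ := mem_image.mp hb
    obtain ⟨hfc, hfZ, hfy⟩ := mem_filter.mp (hDC hf)
    refine le_trans ?_ (hfy y hy)
    have : deg G (f w) (A y \ nbrsIn G ((univ.erase w).biUnion X) (A y)) ≤
        #(extensions G p f (A y)) := by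
      apply card_le_card
      intro z hz
      obtain ⟨hz, hadj⟩ := mem_filter.mp hz
      obtain ⟨hzA, hzU⟩ := mem_sdiff.mp hz
      exact (mem_copies.mp hfc).2.mem_extensions hp hp0 w rfl
        (fun a ha => mem_biUnion.mpr ⟨a, by simp [ha], hDX f hf a ha⟩) hzA hadj hzU
    gcongr

lemma deg_mono {v : W} {X Y : Finset W} (h : X ⊆ Y) : deg G v X ≤ deg G v Y :=
  card_le_card (filter_subset_filter _ h)

lemma sum_deg_comm (X Y : Finset W) : ∑ v ∈ X, deg G v Y = ∑ v ∈ Y, deg G v X := by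
  simp only [deg, card_filter]
  rw [sum_comm]
  simp only [G.adj_comm]

/-- Passing from bounds on the density to bounds on the maximum degree between blocks. -/
lemma exists_trim {J : Finset ℕ} {q : ℕ} (hJ : #J ≤ q) {B : ℕ → Finset W}
    (hB : ∀ x ∈ J, (B x).Nonempty) {D : ℝ} (hD : 0 < D)
    (h : ∀ x ∈ J, ∀ y ∈ J, x ≠ y → (∑ v ∈ B x, deg G v (B y) : ℝ) ≤ D * #(B x) * #(B y)) :
    ∃ B' : ℕ → Finset W, ∀ x ∈ J, B' x ⊆ B x ∧ (#(B x) : ℝ) ≤ 2 * #(B' x) ∧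
      ∀ y ∈ J, x ≠ y → ∀ v ∈ B' x, (deg G v (B' y) : ℝ) ≤ 4 * q * D * #(B' y) := by
  -- By Markov, each of the at most `q` other blocks disqualifies at most a fraction `1 / (2 * q)`
  -- of `B x`, so half survives. Measuring degrees against halved blocks turns the threshold `2 * q
  -- * D` into `4 * q * D`.
  set B' : ℕ → Finset W := fun x =>
    {v ∈ B x | ∀ y ∈ J, x ≠ y → (deg G v (B y) : ℝ) ≤ 2 * q * D * #(B y)} with hB'
  have hsub : ∀ x, B' x ⊆ B x := fun x => filter_subset _ _
  have hbig : ∀ x ∈ J, (#(B x) : ℝ) ≤ 2 * #(B' x) := by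
    intro x hx
    have hq : (0 : ℝ) < q := by
      have : 0 < #J := card_pos.mpr ⟨x, hx⟩
      exact_mod_cast this.trans_le hJ
    set bad : ℕ → Finset W := fun y => {v ∈ B x | 2 * q * D * #(B y) < (deg G v (B y) : ℝ)}
    have h1 : ∀ y ∈ J.erase x, (#(bad y) : ℝ) ≤ #(B x) / (2 * q) := by
      intro y hy
      obtain ⟨hyx, hy⟩ := mem_erase.mp hy
      have hBy : (0 : ℝ) < #(B y) := by exact_mod_cast card_pos.mpr (hB y hy)
      have h2 : #(bad y) * (2 * q * D * #(B y)) ≤ D * #(B x) * #(B y) := by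
        calc #(bad y) * (2 * q * D * #(B y)) = ∑ v ∈ bad y, (2 * q * D * #(B y)) := by simp
          _ ≤ ∑ v ∈ bad y, (deg G v (B y) : ℝ) :=
              sum_le_sum fun v hv => (mem_filter.mp hv).2.le
          _ ≤ ∑ v ∈ B x, (deg G v (B y) : ℝ) :=
              sum_le_sum_of_subset_of_nonneg (filter_subset _ _) fun _ _ _ => by positivity
          _ ≤ _ := h x hx y hy hyx.symm
      rw [le_div_iff₀ (by positivity)]
      have h3 : (#(bad y) * (2 * q)) * (D * #(B y)) ≤ #(B x) * (D * #(B y)) := by linarith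
      exact le_of_mul_le_mul_right h3 (by positivity)
    have h4 : B x ⊆ B' x ∪ (J.erase x).biUnion bad := by
      intro v hv
      by_cases hv' : ∀ y ∈ J, x ≠ y → (deg G v (B y) : ℝ) ≤ 2 * q * D * #(B y)
      · exact mem_union_left _ (mem_filter.mpr ⟨hv, hv'⟩)
      · push Not at hv'
        obtain ⟨y, hy, hxy, hlt⟩ := hv'
        exact mem_union_right _ (mem_biUnion.mpr
          ⟨y, mem_erase.mpr ⟨hxy.symm, hy⟩, mem_filter.mpr ⟨hv, hlt⟩⟩)
    have h5 : (#(B x) : ℝ) ≤ #(B' x) + ∑ y ∈ J.erase x, (#(bad y) : ℝ) := by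
      exact_mod_cast (card_le_card h4).trans ((card_union_le _ _).trans
        (Nat.add_le_add_left card_biUnion_le _))
    have h6 : ∑ y ∈ J.erase x, (#(bad y) : ℝ) ≤ q * (#(B x) / (2 * q)) := by
      calc _ ≤ ∑ y ∈ J.erase x, (#(B x) / (2 * q) : ℝ) := sum_le_sum h1
        _ = #(J.erase x) * (#(B x) / (2 * q) : ℝ) := by simp
        _ ≤ _ := by
          have : (#(J.erase x) : ℝ) ≤ q := by
            exact_mod_cast (card_le_card (erase_subset _ _)).trans hJ
          gcongr
    have h7 : q * (#(B x) / (2 * q) : ℝ) = #(B x) / 2 := by field_simp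
    linarith
  refine ⟨B', fun x hx => ⟨hsub x, hbig x hx, fun y hy hxy v hv => ?_⟩⟩
  calc (deg G v (B' y) : ℝ) ≤ deg G v (B y) := by exact_mod_cast deg_mono (hsub y)
    _ ≤ 2 * q * D * #(B y) := (mem_filter.mp hv).2 y hy hxy
    _ ≤ 2 * q * D * (2 * #(B' y)) := by have := hbig y hy; gcongr
    _ = _ := by ring

/-- Richness is robust under shrinking: apply it to the family in which only the block of the parent
`p (i + 1)` is replaced, by `Z`. -/
lemma half_le_card_filter_of_isRich (hp : ∀ a, 1 ≤ a → p a < a) {i : ℕ}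
    {A : ℕ → Finset W} {τ : ℕ → ℕ} {Δ E : ℝ} (hΔ : 0 < Δ) (hE0 : 0 ≤ E)
    (hτ : ∀ a ≤ i, ∀ b ≤ i, a ≠ b → τ a ≠ τ b) (hrich : IsRich G p i A τ Δ E (1 / 2))
    {Z : Finset W} (hZA : Z ⊆ A (τ (p (i + 1)))) (hZ : (#(A (τ (p (i + 1)))) : ℝ) ≤ 2 * #Z) :
    Δ ^ i * ∏ a ∈ range (i + 1), (#(A (τ a)) : ℝ) ≤
      2 * (E * #{f ∈ copies G p (i + 1) A τ | f ⟨p (i + 1), hp _ (by omega)⟩ ∈ Z}) := by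
  set w := p (i + 1) with hw
  have hwi : w < i + 1 := hp _ (by omega)
  have hupd : ∀ a ∈ (range (i + 1)).erase w, Function.update A (τ w) Z (τ a) = A (τ a) := by
    intro a ha
    obtain ⟨haw, ha⟩ := mem_erase.mp ha
    rw [mem_range] at ha
    exact Function.update_of_ne (hτ a (by omega) w (by omega) haw) _ _
  have h1 := hrich (Function.update A (τ w) Z) (fun x => by
    by_cases hx : x = τ w
    · subst hx; simp only [Function.update_self]; exact ⟨hZA, by linarith⟩
    · simp only [Function.update_of_ne hx]
      exact ⟨subset_rfl, by have : (0 : ℝ) ≤ #(A x) := by positivity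
                            linarith⟩)
  have h2 : copies G p (i + 1) (Function.update A (τ w) Z) τ ⊆
      {f ∈ copies G p (i + 1) A τ | f ⟨w, hwi⟩ ∈ Z} := by
    intro f hf
    have hf' := mem_copies.mp hf
    refine mem_filter.mpr ⟨mem_copies.mpr ⟨fun a => ?_, hf'.2⟩, ?_⟩
    · by_cases ha : (a : ℕ) = w
      · have := hf'.1 a
        rw [ha, Function.update_self] at this
        rw [ha]; exact hZA this
      · rw [← hupd a (by simp only [mem_erase, mem_range]; exact ⟨ha, a.2⟩)]; exact hf'.1 a
    · simpa using hf'.1 ⟨w, hwi⟩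
  rw [← mul_prod_erase _ _ (mem_range.mpr hwi), prod_congr rfl (fun a ha => by rw [hupd a ha]),
    Function.update_self] at h1
  rw [← mul_prod_erase _ _ (mem_range.mpr hwi)]
  have hE : E * #(copies G p (i + 1) (Function.update A (τ w) Z) τ) ≤
      E * #{f ∈ copies G p (i + 1) A τ | f ⟨w, hwi⟩ ∈ Z} := by
    have : (#(copies G p (i + 1) (Function.update A (τ w) Z) τ) : ℝ) ≤
      #{f ∈ copies G p (i + 1) A τ | f ⟨w, hwi⟩ ∈ Z} := by exact_mod_cast card_le_card h2
    exact mul_le_mul_of_nonneg_left this hE0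
  set Q := ∏ a ∈ (range (i + 1)).erase w, (#(A (τ a)) : ℝ)
  have hQ0 : 0 ≤ Q := prod_nonneg fun _ _ => by positivity
  clear_value Q
  have h3 : Δ ^ i * (#(A (τ w)) * Q) ≤ 2 * (Δ ^ i * (#Z * Q)) := by
    have : 0 ≤ Δ ^ i * Q := mul_nonneg (pow_nonneg hΔ.le i) hQ0
    nlinarith
  linarith

/-- Vertices in a block of `I` have degree at most `Δ |A y|` to every other block `A y`. -/
def IsSparse (G : SimpleGraph W) (A : ℕ → Finset W) (I : Finset ℕ) (Δ : ℝ) : Prop :=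
  ∀ x ∈ I, ∀ y ∈ I, x ≠ y → ∀ v ∈ A x, (deg G v (A y) : ℝ) ≤ Δ * #(A y)

/-- The tuples are treated in order, with `exists_sparse_part` applied to tuple `j` against the
parent blocks of all later tuples. It makes `B j` sparse only to what lies outside the neighbours of
the small set `U j`, so later sets `B j'` are chosen to avoid those neighbours. The new leaf is
sought in the parent block of a later tuple so that both ends of each sparse pair are parent blocks.
-/
lemma exists_sparse_family (hp : ∀ a, 1 ≤ a → p a < a) (hp0 : p 0 = 0) {i q : ℕ}
    {A A₁ : ℕ → Finset W} {I : Finset ℕ} {τ : ℕ → ℕ → ℕ} {Δ E E' K δ l : ℝ}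
    (hΔ : 0 < Δ) (hE : 0 < E) (hK : 0 < K) (hE' : 0 ≤ E')
    (hA : ∀ x, (A₁ x).Nonempty) (hsub : IsFraction l A A₁) (hdeg : IsSparse G A I Δ)
    (hτ : ∀ j < q, ∀ a ≤ i, τ j a ∈ I)
    (hinj : ∀ j < q, ∀ a ≤ i, ∀ j' < q, ∀ b ≤ i, τ j a = τ j' b → j = j' ∧ a = b)
    (hrich : ∀ j < q, IsRich G p i A₁ (τ j) Δ E (1 / 2))
    (hlow : ∀ j j', j < j' → j' < q →
      E' * #(copies G p (i + 2) A₁ (Function.update (τ j) (i + 1) (τ j' (p (i + 1))))) ≤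
      K * (Δ ^ (i + 1) * ((∏ a ∈ range (i + 1), (#(A₁ (τ j a)) : ℝ)) *
        #(A₁ (τ j' (p (i + 1)))))))
    (hδ0 : 0 ≤ δ) (hδ : q * i * δ ≤ l / 2) (hδl : δ ≤ l) (hΔδ : Δ ≤ δ) :
    ∃ B : ℕ → Finset W, ∀ j < q, B j ⊆ A₁ (τ j (p (i + 1))) ∧
      (δ / 4) ^ i * #(A₁ (τ j (p (i + 1)))) ≤ 4 * E * #(B j) ∧
      ∀ j', j < j' → j' < q → ∀ b ∈ B j,
        E' * deg G b (B j') ≤ 4 * q * K * E * Δ * #(A₁ (τ j' (p (i + 1)))) := by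
  have hwi : p (i + 1) ≤ i := Nat.lt_succ_iff.mp (hp _ (by omega))
  suffices H : ∀ t ≤ q, ∃ U B : ℕ → Finset W, ∀ j < t, B j ⊆ A₁ (τ j (p (i + 1))) ∧
      (δ / 4) ^ i * #(A₁ (τ j (p (i + 1)))) ≤ 4 * E * #(B j) ∧
      (∀ j' < t, j < j' → Disjoint (B j') (nbrsIn G (U j) (A₁ (τ j' (p (i + 1)))))) ∧
      ∀ j', j < j' → j' < q →
        (#(nbrsIn G (U j) (A₁ (τ j' (p (i + 1))))) : ℝ) ≤ i * δ * #(A (τ j' (p (i + 1)))) ∧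
        ∀ b ∈ B j,
        E' * deg G b (A₁ (τ j' (p (i + 1))) \ nbrsIn G (U j) (A₁ (τ j' (p (i + 1))))) ≤
          4 * q * K * E * Δ * #(A₁ (τ j' (p (i + 1)))) by
    obtain ⟨U, B, h⟩ := H q le_rfl
    refine ⟨B, fun j hj => ⟨(h j hj).1, (h j hj).2.1, fun j' hjj' hj' b hb => ?_⟩⟩
    refine le_trans ?_ (((h j hj).2.2.2 j' hjj' hj').2 b hb)
    have : deg G b (B j') ≤ deg G b
        (A₁ (τ j' (p (i + 1))) \ nbrsIn G (U j) (A₁ (τ j' (p (i + 1))))) :=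
      deg_mono (subset_sdiff.mpr ⟨(h j' hj').1, (h j hj).2.2.1 j' hj' hjj'⟩)
    have : (deg G b (B j') : ℝ) ≤ deg G b
        (A₁ (τ j' (p (i + 1))) \ nbrsIn G (U j) (A₁ (τ j' (p (i + 1))))) := by exact_mod_cast this
    exact mul_le_mul_of_nonneg_left this hE'
  intro t
  induction t with
  | zero => exact fun _ => ⟨fun _ => ∅, fun _ => ∅, fun j hj => absurd hj (by omega)⟩
  | succ t ih =>
    intro ht
    obtain ⟨U, B, h⟩ := ih (by omega)
    set w := τ t (p (i + 1)) with hw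
    set R := (range t).biUnion (fun j => nbrsIn G (U j) (A₁ w)) with hR
    -- Fewer than `q` earlier tuples each forbid at most `i * δ * #(A w)` vertices, and `hδ` makes
    -- the total at most half of `A₁ w`.
    have hRcard : (#R : ℝ) ≤ #(A₁ w) / 2 := by
      have h1 : (#R : ℝ) ≤ ∑ j ∈ range t, (#(nbrsIn G (U j) (A₁ w)) : ℝ) := by
        exact_mod_cast card_biUnion_le
      have h2 : ∑ j ∈ range t, (#(nbrsIn G (U j) (A₁ w)) : ℝ) ≤
          ∑ j ∈ range t, i * δ * (#(A w) : ℝ) :=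
        sum_le_sum fun j hj => ((h j (mem_range.mp hj)).2.2.2 t (mem_range.mp hj) (by omega)).1
      have h3 : ∑ j ∈ range t, i * δ * (#(A w) : ℝ) = (t * i * δ) * #(A w) := by simp; ring
      have htq : (t : ℝ) ≤ q := by exact_mod_cast (by omega : t ≤ q)
      have h4 : t * i * δ ≤ l / 2 := by
        refine le_trans ?_ hδ
        have : 0 ≤ i * δ := by positivity
        nlinarith
      have h5 := mul_le_mul_of_nonneg_right h4 (by positivity : (0 : ℝ) ≤ #(A w))
      have h6 := (hsub w).2
      linarith
    set Z := A₁ w \ R with hZ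
    have hZcard : (#(A₁ w) : ℝ) ≤ 2 * #Z := by
      have : (#(A₁ w) : ℝ) ≤ #Z + #R := by
        have := card_le_card_sdiff_add_card (s := A₁ w) (t := R)
        exact_mod_cast this
      linarith
    have htq : t < q := by omega
    have hhalf := half_le_card_filter_of_isRich hp hΔ hE.le
      (fun a ha b hb hab hab' => hab (hinj t htq a ha t htq b hb hab').2)
      (hrich t htq) (Z := Z) sdiff_subset hZcard
    rw [← mul_assoc] at hhalf
    have hdeg' : ∀ x ∈ I, ∀ y ∈ I, x ≠ y → ∀ v ∈ A₁ x, (deg G v (A₁ y) : ℝ) ≤ Δ * #(A y) := by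
      intro x hx y hy hxy v hv
      refine le_trans ?_ (hdeg x hx y hy hxy v ((hsub x).1 hv))
      exact_mod_cast deg_mono (hsub y).1
    obtain ⟨U', B', hBZ, hBA, hBcard, hU', hB'⟩ := exists_sparse_part (G := G) hp hp0
      (A := A₁) (τ := τ t) (N := fun x => #(A x))
      (Y := ({j' ∈ range q | t < j'}).image (fun j' => τ j' (p (i + 1))))
      (q := q) (δ := δ) (l := l) hΔ hE hK hE'
      (card_image_le.trans ((card_filter_le _ _).trans (by simp)))
      hA (fun _ => by positivity) (fun x => (hsub x).2) hδl hΔδ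
      (fun a ha b hb hab v hv => hdeg' _ (hτ t htq b hb) _ (hτ t htq a ha)
        (fun hab' => hab (hinj t htq b hb t htq a ha hab').2.symm) v hv)
      (by
        simp only [mem_image, mem_filter, mem_range]
        rintro _ ⟨j', ⟨hj', htj'⟩, rfl⟩ b hb v hv
        exact hdeg' _ (hτ t htq b hb) _ (hτ j' hj' _ hwi)
          (fun h' => htj'.ne (hinj t htq b hb j' hj' _ hwi h').1) v hv)
      (by
        simp only [mem_image, mem_filter, mem_range]
        rintro _ ⟨j', ⟨hj', htj'⟩, rfl⟩
        exact hlow t j' htj' hj')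
      hhalf
    have hY : ∀ j', t < j' → j' < q → τ j' (p (i + 1)) ∈
        ({j' ∈ range q | t < j'}).image (fun j' => τ j' (p (i + 1))) := fun j' h1 h2 =>
      mem_image.mpr ⟨j', mem_filter.mpr ⟨mem_range.mpr h2, h1⟩, rfl⟩
    refine ⟨Function.update U t U', Function.update B t B', fun j hj => ?_⟩
    rcases eq_or_ne j t with rfl | hjt
    · simp only [Function.update_self]
      exact ⟨hBA, hBcard, fun j' hj' hjj' => by omega,
        fun j' hjj' hj' => ⟨hU' _ (hY j' hjj' hj'), fun b hb => hB' b hb _ (hY j' hjj' hj')⟩⟩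
    · simp only [Function.update_of_ne hjt]
      have hj' : j < t := by omega
      refine ⟨(h j hj').1, (h j hj').2.1, fun j' hj'' hjj' => ?_, (h j hj').2.2.2⟩
      rcases eq_or_ne j' t with rfl | hj't
      · simp only [Function.update_self]
        refine disjoint_left.mpr fun b hb hb' => ?_
        exact (mem_sdiff.mp (hBZ hb)).2 (mem_biUnion.mpr ⟨j, mem_range.mpr hj', hb'⟩)
      · simp only [Function.update_of_ne hj't]
        exact (h j hj').2.2.1 j' (by omega) hjj'

/-- Some `q` blocks of `I` can be shrunk by a factor `r ^ l` so that the degrees between them,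
relative to the sizes, decrease by a factor `r ^ (C * l)`. -/
def Drops (G : SimpleGraph W) (A : ℕ → Finset W) (I : Finset ℕ) (q : ℕ) (r Δ : ℝ) (C L : ℕ) :
    Prop :=
  ∃ l, 1 ≤ l ∧ l ≤ L ∧ ∃ J ⊆ I, #J = q ∧ ∃ B : ℕ → Finset W, ∀ x ∈ J, B x ⊆ A x ∧
    (#(A x) : ℝ) ≤ r ^ l * #(B x) ∧
    ∀ y ∈ J, x ≠ y → ∀ v ∈ B x, r ^ (C * l) * (deg G v (B y) : ℝ) ≤ Δ * #(B y)

/-- Sizes shrink by `E = r ^ e` up to constants, and densities become `E ^ 2 * Δ / E'` up to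
constants: one `E` is the fraction of copies, the other comes from renormalising by the smaller
blocks. The exponent of `E'` is chosen to beat this by `r ^ (C * (e + 1))` with one factor `r` to
spare, which absorbs the constants. -/
lemma drops_of_low (hp : ∀ a, 1 ≤ a → p a < a) (hp0 : p 0 = 0) {i q C L e : ℕ}
    {A A₁ : ℕ → Finset W} {I : Finset ℕ} {τ : ℕ → ℕ → ℕ} {Δ r K δ l : ℝ}
    (hq : 0 < q) (hΔ : 0 < Δ) (hK : 0 < K) (hl : 0 < l) (hr : 1 ≤ r) (he : e + 1 ≤ L)
    (hA : ∀ x, (A₁ x).Nonempty) (hsub : IsFraction l A A₁) (hdeg : IsSparse G A I Δ)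
    (hτ : ∀ j < q, ∀ a ≤ i, τ j a ∈ I)
    (hinj : ∀ j < q, ∀ a ≤ i, ∀ j' < q, ∀ b ≤ i, τ j a = τ j' b → j = j' ∧ a = b)
    (hrich : ∀ j < q, IsRich G p i A₁ (τ j) Δ (r ^ e) (1 / 2))
    (hlow : ∀ j j', j < j' → j' < q →
      r ^ ((C + 2) * e + C + 1) *
        #(copies G p (i + 2) A₁ (Function.update (τ j) (i + 1) (τ j' (p (i + 1))))) ≤
      K * (Δ ^ (i + 1) * ((∏ a ∈ range (i + 1), (#(A₁ (τ j a)) : ℝ)) *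
        #(A₁ (τ j' (p (i + 1)))))))
    (hδ0 : 0 < δ) (hδ : q * i * δ ≤ l / 2) (hδl : δ ≤ l) (hΔδ : Δ ≤ δ)
    (hr1 : 8 / l * (4 / δ) ^ i ≤ r) (hr2 : 64 * q ^ 2 * K * (4 / δ) ^ i ≤ r) :
    Drops G A I q r Δ C L := by
  have hwi : p (i + 1) ≤ i := Nat.lt_succ_iff.mp (hp _ (by omega))
  have hr0 : 0 < r := by linarith
  obtain ⟨B, hB⟩ := exists_sparse_family hp hp0 hΔ (pow_pos hr0 e) hK
    (pow_pos hr0 ((C + 2) * e + C + 1)).le hA hsub hdeg hτ hinj hrich hlow hδ0.le hδ hδl hΔδ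
  set w : Fin q → ℕ := fun j => τ j (p (i + 1)) with hw
  have hwinj : Function.Injective w := fun j j' h =>
    Fin.ext (hinj j j.2 _ hwi j' j'.2 _ hwi h).1
  set B₁ : ℕ → Finset W := Function.extend w (fun j => B j) (fun _ => ∅) with hB₁
  have hB₁w : ∀ j : Fin q, B₁ (w j) = B j := fun j => hwinj.extend_apply _ _ _
  have hApos : ∀ x, (0 : ℝ) < #(A₁ x) := fun x => by exact_mod_cast card_pos.mpr (hA x)
  set H := (4 / δ) ^ i with hH
  have hH0 : 0 < H := by positivity
  have hHδ : H * (δ / 4) ^ i = 1 := by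
    rw [hH, ← mul_pow]; field_simp; simp
  clear_value H
  set E := r ^ e with hE
  have hE0 : 0 < E := pow_pos hr0 e
  set E' := r ^ ((C + 2) * e + C + 1) with hE'
  have hE'0 : 0 < E' := pow_pos hr0 _
  have hE'E : E' = r ^ (C * (e + 1)) * (E ^ 2 * r) := by
    rw [hE', hE, ← pow_mul, ← pow_succ, ← pow_add]; congr 1; ring
  clear_value E'
  have hrl : r ^ (e + 1) = E * r := by rw [hE, pow_succ]
  clear_value E
  have hsize : ∀ j : Fin q, (#(A₁ (w j)) : ℝ) ≤ H * (4 * E * #(B j)) := by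
    intro j
    have := mul_le_mul_of_nonneg_left (hB j j.2).2.1 hH0.le
    rwa [← mul_assoc, hHδ, one_mul] at this
  have hBpos : ∀ j : Fin q, (0 : ℝ) < #(B j) := by
    intro j
    have h1 := (hApos (w j)).trans_le (hsize j)
    by_contra! hcon
    have : H * (4 * E * #(B j)) ≤ 0 :=
      mul_nonpos_of_nonneg_of_nonpos hH0.le (mul_nonpos_of_nonneg_of_nonpos (by positivity) hcon)
    linarith
  set D := 16 * q * K * H * E ^ 2 * Δ / E' with hD
  have hD0 : 0 < D := by
    have : (0 : ℝ) < q := by exact_mod_cast hq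
    positivity
  have hDE : D * E' = 16 * q * K * H * E ^ 2 * Δ := div_mul_cancel₀ _ hE'0.ne'
  have hdens : ∀ j j' : Fin q, j < j' →
      (∑ v ∈ B j, deg G v (B j') : ℝ) ≤ D * #(B j) * #(B j') := by
    intro j j' hjj'
    have h1 : ∀ v ∈ B j, (deg G v (B j') : ℝ) ≤ D * #(B j') := by
      intro v hv
      have h2 := (hB j j.2).2.2 j' hjj' j'.2 v hv
      have h3 := mul_le_mul_of_nonneg_left (hsize j')
        (by positivity : 0 ≤ 4 * q * K * E * Δ)
      have h4 : E' * deg G v (B j') ≤ 16 * q * K * H * E ^ 2 * Δ * #(B j') :=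
        (h2.trans h3).trans (le_of_eq (by ring))
      rw [hD, div_mul_eq_mul_div, le_div_iff₀ hE'0]
      linarith
    calc (∑ v ∈ B j, deg G v (B j') : ℝ) ≤ ∑ v ∈ B j, D * #(B j') := sum_le_sum h1
      _ = _ := by simp; ring
  have hmem : ∀ x ∈ univ.image w, ∃ j : Fin q, w j = x := by simp
  obtain ⟨B', hB'⟩ := exists_trim (G := G) (J := univ.image w) (q := q) (B := B₁) (D := D)
    (card_image_le.trans (by simp))
    (by
      intro x hx
      obtain ⟨j, rfl⟩ := hmem x hx
      rw [hB₁w]; exact card_pos.mp (by exact_mod_cast hBpos j))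
    hD0
    (by
      intro x hx y hy hxy
      obtain ⟨j, rfl⟩ := hmem x hx
      obtain ⟨j', rfl⟩ := hmem y hy
      rw [hB₁w, hB₁w]
      rcases lt_trichotomy j j' with h | h | h
      · exact hdens j j' h
      · exact absurd (congrArg w h) hxy
      -- Sparsity is known only from earlier to later tuples, but density is symmetric; trimming
      -- then gives degree bounds both ways.
      · have h1 := hdens j' j h
        have h2 : (∑ v ∈ B j, deg G v (B j') : ℝ) = ∑ v ∈ B j', (deg G v (B j) : ℝ) := by
          exact_mod_cast sum_deg_comm (B j) (B j')
        rw [h2]; linarith)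
  refine ⟨e + 1, by omega, he, univ.image w, ?_, ?_, B', fun x hx => ?_⟩
  · intro x hx
    obtain ⟨j, rfl⟩ := hmem x hx
    exact hτ j j.2 _ hwi
  · rw [card_image_of_injective _ hwinj]; simp
  obtain ⟨h1, h2, h3⟩ := hB' x hx
  obtain ⟨j, rfl⟩ := hmem x hx
  rw [hB₁w] at h1 h2
  refine ⟨(h1.trans (hB j j.2).1).trans (hsub _).1, ?_, fun y hy hxy v hv => ?_⟩
  · have h4 : l * #(A (w j)) ≤ 8 * H * E * #(B' (w j)) := by
      have := mul_le_mul_of_nonneg_left h2 (mul_nonneg hH0.le (mul_nonneg zero_le_four hE0.le))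
      have := hsize j
      have := (hsub (w j)).2
      linarith
    have h5 : (#(A (w j)) : ℝ) ≤ (8 / l * H) * (E * #(B' (w j))) := by
      refine le_of_mul_le_mul_left (h4.trans (le_of_eq ?_)) hl
      have h6 : l * (8 / l) = 8 := mul_div_cancel₀ _ hl.ne'
      calc 8 * H * E * (#(B' (w j)) : ℝ) = (l * (8 / l)) * H * E * #(B' (w j)) := by rw [h6]
        _ = _ := by ring
    refine h5.trans ?_
    rw [hrl]
    have := mul_le_mul_of_nonneg_right hr1 (mul_nonneg hE0.le (Nat.cast_nonneg #(B' (w j))))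
    linarith
  · have h4 := h3 y hy hxy v hv
    have h5 := mul_le_mul_of_nonneg_left h4 (pow_pos hr0 (C * (e + 1))).le
    refine h5.trans ?_
    have h6 : r ^ (C * (e + 1)) * (4 * q * D * #(B' y)) * (E ^ 2 * r) =
        (64 * q ^ 2 * K * H) * (E ^ 2 * (Δ * #(B' y))) := by
      calc _ = 4 * q * #(B' y) * (D * E') := by rw [hE'E]; ring
        _ = _ := by rw [hDE]; ring
    have h7 := mul_le_mul_of_nonneg_right hr2
      (mul_nonneg (sq_nonneg E) (mul_nonneg hΔ.le (Nat.cast_nonneg #(B' y))))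
    have h8 : 0 < E ^ 2 * r := mul_pos (pow_pos hE0 2) hr0
    refine le_of_mul_le_mul_right (?_ : _ * (E ^ 2 * r) ≤ _) h8
    rw [h6]; linarith

/-! ### Ordered index sets with large gaps -/

lemma exists_enumeration {α : Type*} [LinearOrder α] [Nonempty α] (I : Finset α) :
    ∃ g : ℕ → α, (∀ n < #I, g n ∈ I) ∧ ∀ a b, a < b → b < #I → g a < g b := by
  refine ⟨fun n => if h : n < #I then I.orderEmbOfFin rfl ⟨n, h⟩ else Classical.arbitrary α,
    fun n hn => ?_, fun a b hab hb => ?_⟩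
  · simp only [hn, dif_pos]; exact orderEmbOfFin_mem _ _ _
  · simp only [hb, hab.trans hb, dif_pos]
    exact (I.orderEmbOfFin rfl).strictMono hab

/-- Every sufficiently large set of naturals has a subset of given size all of whose cuts contain
many elements of the original set. -/
lemma exists_spaced_subset (N m : ℕ) {I : Finset ℕ} (hI : N * (m + 1) + m ≤ #I) :
    ∃ I' ⊆ I, #I' = N ∧ ∀ S ⊆ I', ∀ S' ⊆ I', (∀ s ∈ S, ∀ s' ∈ S', s < s') →
      m ≤ #{x ∈ I | (∀ s ∈ S, s < x) ∧ ∀ s' ∈ S', x < s'} := by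
  obtain ⟨g, hgI, hg⟩ := exists_enumeration I
  have hidx : ∀ j s, j ≤ N → s < m → j * (m + 1) + s < #I := fun j s hj hs => by
    have := Nat.mul_le_mul_right (m + 1) hj
    omega
  have hidx' : ∀ j < N, j * (m + 1) + m < #I := fun j hj => by
    have := Nat.mul_le_mul_right (m + 1) (Nat.succ_le_of_lt hj)
    rw [Nat.succ_mul] at this
    omega
  have hmono : ∀ j j', j < j' → j * (m + 1) + m < j' * (m + 1) := fun j j' h => by
    have := Nat.mul_le_mul_right (m + 1) (Nat.succ_le_of_lt h)
    rw [Nat.succ_mul] at this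
    omega
  -- Every `(m + 1)`-st element is selected, leaving `m` unselected ones before each and `m` after
  -- the last.
  set h : ℕ → ℕ := fun j => g (j * (m + 1) + m) with hh
  have hlt : ∀ j j', j < j' → j' < N → h j < h j' := fun j j' hjj' hj' =>
    hg _ _ (by have := hmono j j' hjj'; omega) (hidx' j' hj')
  refine ⟨(range N).image h, ?_, ?_, fun S hS S' hS' hSS' => ?_⟩
  · intro x hx
    obtain ⟨j, hj, rfl⟩ := mem_image.mp hx
    exact hgI _ (hidx' j (mem_range.mp hj))
  · rw [card_image_of_injOn, card_range]
    intro a ha b hb hab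
    simp only [coe_range, Set.mem_Iio] at ha hb
    rcases lt_trichotomy a b with h1 | h1 | h1
    · exact absurd hab (hlt a b h1 hb).ne
    · exact h1
    · exact absurd hab (hlt b a h1 ha).ne'
  · set t := ({j ∈ range N | h j ∈ S}).sup (· + 1) with ht
    have htN : t ≤ N := Finset.sup_le fun j hj => by
      have := mem_range.mp (mem_filter.mp hj).1; omega
    calc m = #((range m).image (fun s => g (t * (m + 1) + s))) := by
          rw [card_image_of_injOn, card_range]
          intro a ha b hb hab
          simp only [coe_range, Set.mem_Iio] at ha hb
          rcases lt_trichotomy a b with h1 | h1 | h1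
          · exact absurd hab (hg _ _ (by omega) (hidx t b htN hb)).ne
          · exact h1
          · exact absurd hab (hg _ _ (by omega) (hidx t a htN ha)).ne'
      _ ≤ _ := card_le_card ?_
    intro x hx
    obtain ⟨s, hs, rfl⟩ := mem_image.mp hx
    rw [mem_range] at hs
    refine mem_filter.mpr ⟨hgI _ (hidx t s htN hs), fun y hy => ?_, fun y hy => ?_⟩
    · obtain ⟨j, hj, rfl⟩ := mem_image.mp (hS hy)
      have : j + 1 ≤ t := le_sup (f := (· + 1)) (mem_filter.mpr ⟨hj, hy⟩)
      exact hg _ _ (by have := hmono j t this; omega) (hidx t s htN hs)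
    · obtain ⟨j', hj', rfl⟩ := mem_image.mp (hS' hy)
      rw [mem_range] at hj'
      have htj' : t ≤ j' := Finset.sup_le fun j hj => by
        obtain ⟨hj, hjS⟩ := mem_filter.mp hj
        by_contra! hcon
        have h1 := hSS' _ hjS _ hy
        rcases eq_or_lt_of_le (Nat.lt_succ_iff.mp hcon) with rfl | h2
        · exact lt_irrefl _ h1
        · exact lt_asymm h1 (hlt _ _ h2 (mem_range.mp hj))
      refine hg _ _ ?_ (hidx' j' hj')
      have := Nat.mul_le_mul_right (m + 1) htj'
      omega

/-! ### Richness under shrinking -/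

lemma IsFraction.refl {A : ℕ → Finset W} : IsFraction 1 A A := fun x => ⟨subset_rfl, by simp⟩

lemma IsFraction.mono {A A' : ℕ → Finset W} {κ κ' : ℝ} (h : IsFraction κ A A') (hκ : κ' ≤ κ) :
    IsFraction κ' A A' := fun x =>
  ⟨(h x).1, (mul_le_mul_of_nonneg_right hκ (Nat.cast_nonneg _)).trans (h x).2⟩

lemma IsFraction.trans {A A' A'' : ℕ → Finset W} {κ κ' : ℝ} (hκ' : 0 ≤ κ')
    (h : IsFraction κ A A') (h' : IsFraction κ' A' A'') : IsFraction (κ * κ') A A'' := fun x =>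
  ⟨(h' x).1.trans (h x).1, by
    have := mul_le_mul_of_nonneg_left (h x).2 hκ'
    have := (h' x).2
    linarith⟩

lemma IsFraction.nonempty {A A' : ℕ → Finset W} {κ : ℝ} (hκ : 0 < κ) (h : IsFraction κ A A')
    (hA : ∀ x, (A x).Nonempty) (x : ℕ) : (A' x).Nonempty := by
  have h1 : (0 : ℝ) < #(A x) := by exact_mod_cast card_pos.mpr (hA x)
  have h2 : (0 : ℝ) < #(A' x) := (mul_pos hκ h1).trans_le (h x).2
  exact card_pos.mp (by exact_mod_cast h2)

lemma IsRich.of_isFraction {i : ℕ} {A A' : ℕ → Finset W} {τ : ℕ → ℕ} {Δ E κ κ' μ : ℝ}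
    (h : IsRich G p i A τ Δ E κ) (hA : IsFraction μ A A') (hκ' : 0 ≤ κ') (hκ : κ ≤ μ * κ') :
    IsRich G p i A' τ Δ E κ' := fun A'' hA'' => h A'' ((hA.trans hκ' hA'').mono hκ)

/-- Only the blocks indexed by `τ` matter, so families obtained for disjoint tuples can be glued. -/
lemma IsRich.congr {i : ℕ} {A A' : ℕ → Finset W} {τ : ℕ → ℕ} {Δ E κ : ℝ} (hκ : κ ≤ 1)
    (h : IsRich G p i A τ Δ E κ) (hA : ∀ a ≤ i, A (τ a) = A' (τ a)) :
    IsRich G p i A' τ Δ E κ := by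
  intro A'' hA''
  have h1 := h (fun x => if ∃ a ≤ i, τ a = x then A'' x else A x) (fun x => by
    dsimp only
    split_ifs with hx
    · obtain ⟨a, ha, rfl⟩ := hx
      rw [hA a ha]; exact hA'' _
    · exact IsFraction.refl.mono hκ x)
  have h2 : ∀ a ≤ i, (if ∃ b ≤ i, τ b = τ a then A'' (τ a) else A (τ a)) = A'' (τ a) :=
    fun a ha => if_pos ⟨a, ha, rfl⟩
  rw [copies_congr (A' := A'') (τ' := τ) (fun a ha => h2 a (by omega)),
    prod_congr rfl (fun a ha => by
      rw [h2 a (by have := mem_range.mp ha; omega)])] at h1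
  exact h1

lemma IsSparse.mono {A : ℕ → Finset W} {I I' : Finset ℕ} {Δ : ℝ} (h : IsSparse G A I Δ)
    (hI : I' ⊆ I) : IsSparse G A I' Δ := fun x hx y hy => h x (hI hx) y (hI hy)

lemma Drops.mono {A : ℕ → Finset W} {I I' : Finset ℕ} {q C L : ℕ} {r Δ : ℝ}
    (h : Drops G A I' q r Δ C L) (hI : I' ⊆ I) : Drops G A I q r Δ C L := by
  obtain ⟨l, h1, h2, J, hJ, h3⟩ := h
  exact ⟨l, h1, h2, J, hJ.trans hI, h3⟩

/-- Shrinking the blocks, one can make one of finitely many tuples rich, or else make all of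
them contain few copies. -/
lemma exists_isRich_or_low {ι : Type*} {i : ℕ} {A : ℕ → Finset W} {Δ E κ : ℝ} (hΔ : 0 < Δ)
    (hE : 0 ≤ E) (hκ : 0 < κ) (hκ1 : κ ≤ 1) (σ : ι → ℕ → ℕ) (S : Finset ι) :
    (∃ s ∈ S, ∃ A', IsFraction (κ ^ #S) A A' ∧ IsRich G p i A' (σ s) Δ E κ) ∨
    ∃ A', IsFraction (κ ^ #S) A A' ∧ ∀ s ∈ S, E * #(copies G p (i + 1) A' (σ s)) ≤
      ((κ⁻¹) ^ (i + 1)) ^ #S * (Δ ^ i * ∏ a ∈ range (i + 1), (#(A' (σ s a)) : ℝ)) := by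
  have hκ' : 1 ≤ κ⁻¹ := (one_le_inv₀ hκ).mpr hκ1
  induction S using Finset.induction_on with
  | empty => exact Or.inr ⟨A, by simpa using IsFraction.refl, by simp⟩
  | insert s S hs ih =>
    rw [card_insert_of_notMem hs]
    rcases ih with ⟨s', hs', A', hA', h⟩ | ⟨A', hA', h⟩
    · exact Or.inl ⟨s', mem_insert_of_mem hs', A',
        hA'.mono (pow_le_pow_of_le_one hκ.le hκ1 (by omega)), h⟩
    by_cases hrich : IsRich G p i A' (σ s) Δ E κ
    · exact Or.inl ⟨s, mem_insert_self _ _, A',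
        hA'.mono (pow_le_pow_of_le_one hκ.le hκ1 (by omega)), hrich⟩
    simp only [IsRich, not_forall, not_le] at hrich
    -- A failure of richness is itself a shrinking with few copies. Earlier tuples stay low: their
    -- copies only decrease, while the product of sizes loses at most `κ ^ (i + 1)`.
    obtain ⟨A'', hA'', hlt⟩ := hrich
    refine Or.inr ⟨A'', by rw [pow_succ]; exact hA'.trans hκ.le hA'', fun s' hs' => ?_⟩
    rcases mem_insert.mp hs' with rfl | hs'
    · refine hlt.le.trans (le_mul_of_one_le_left ?_ (one_le_pow₀ (one_le_pow₀ hκ')))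
      exact mul_nonneg (pow_nonneg hΔ.le _) (prod_nonneg fun _ _ => Nat.cast_nonneg _)
    · have h1 : (#(copies G p (i + 1) A'' (σ s')) : ℝ) ≤ #(copies G p (i + 1) A' (σ s')) := by
        exact_mod_cast card_le_card (copies_mono fun a _ => (hA'' _).1)
      have h2 : ∏ a ∈ range (i + 1), (#(A' (σ s' a)) : ℝ) ≤
          (κ⁻¹) ^ (i + 1) * ∏ a ∈ range (i + 1), (#(A'' (σ s' a)) : ℝ) := by
        calc _ ≤ ∏ a ∈ range (i + 1), (κ⁻¹ * (#(A'' (σ s' a)) : ℝ)) := by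
              refine prod_le_prod (fun _ _ => Nat.cast_nonneg _) fun a _ => ?_
              rw [inv_mul_eq_div, le_div_iff₀ hκ, mul_comm]
              exact (hA'' _).2
          _ = _ := by rw [prod_mul_distrib]; simp
      refine (mul_le_mul_of_nonneg_left h1 hE).trans ((h s' hs').trans ?_)
      rw [pow_succ _ #S, mul_assoc]
      refine mul_le_mul_of_nonneg_left ?_ (pow_nonneg (pow_nonneg (by linarith) _) _)
      refine (mul_le_mul_of_nonneg_left h2 (pow_nonneg hΔ.le _)).trans (le_of_eq (by ring))

/-! ### Induction on the size of the tree -/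

/-- The exponents which govern how the number of copies depends on the size of the tree. -/
def expo (C : ℕ) : ℕ → ℕ
  | 0 => 0
  | i + 1 => (C + 2) * expo C i + C + 1

/-- The indices in the tuple `τ` are ordered as prescribed by `π`. -/
def HasOrderType (π : ℕ → ℕ) (i : ℕ) (τ : ℕ → ℕ) : Prop :=
  ∀ a ≤ i, ∀ b ≤ i, π a < π b → τ a < τ b

/-- `x` lies relative to the tuple `τ` as the next index should. -/
def IsNext (π : ℕ → ℕ) (i : ℕ) (τ : ℕ → ℕ) (x : ℕ) : Prop :=
  ∀ a ≤ i, (π a < π (i + 1) → τ a < x) ∧ (π (i + 1) < π a → x < τ a)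

lemma HasOrderType.update {π : ℕ → ℕ} {i : ℕ} {τ : ℕ → ℕ} {x : ℕ} (h : HasOrderType π i τ)
    (hx : IsNext π i τ x) : HasOrderType π (i + 1) (Function.update τ (i + 1) x) := by
  intro a ha b hb hab
  rcases eq_or_ne a (i + 1) with rfl | ha'
  · rcases eq_or_ne b (i + 1) with rfl | hb'
    · exact absurd hab (lt_irrefl _)
    · rw [Function.update_self, Function.update_of_ne hb']
      exact (hx b (by omega)).2 hab
  · rcases eq_or_ne b (i + 1) with rfl | hb'
    · rw [Function.update_self, Function.update_of_ne ha']
      exact (hx a (by omega)).1 hab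
    · rw [Function.update_of_ne ha', Function.update_of_ne hb']
      exact h a (by omega) b (by omega) hab

lemma HasOrderType.inj {π : ℕ → ℕ} {i : ℕ} {τ : ℕ → ℕ} (h : HasOrderType π i τ)
    (hπ : ∀ a ≤ i, ∀ b ≤ i, π a = π b → a = b) {a b : ℕ} (ha : a ≤ i) (hb : b ≤ i)
    (hab : τ a = τ b) : a = b := by
  rcases lt_trichotomy (π a) (π b) with h1 | h1 | h1
  · exact absurd hab (h a ha b hb h1).ne
  · exact hπ a ha b hb h1
  · exact absurd hab (h b hb a ha h1).ne'

lemma IsNext.ne {π : ℕ → ℕ} {i : ℕ} {τ : ℕ → ℕ} {x : ℕ} (h : IsNext π i τ x)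
    (hπ : ∀ a ≤ i, π a ≠ π (i + 1)) {a : ℕ} (ha : a ≤ i) : τ a ≠ x := by
  rcases lt_or_gt_of_ne (hπ a ha) with h1 | h1
  · exact ((h a ha).1 h1).ne
  · exact ((h a ha).2 h1).ne'

/-- In every sparse enough system of sufficiently many blocks, either the relative degrees
between some `q` of the blocks drop polynomially in `r`, or some tuple of blocks is rich. -/
def Dichotomy.{u} (p π : ℕ → ℕ) (C L q i : ℕ) : Prop :=
  ∀ κ : ℝ, 0 < κ → κ ≤ 1 → ∃ (M : ℕ) (δ l r₀ : ℝ), 0 < δ ∧ 0 < l ∧ l ≤ 1 ∧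
    ∀ (W : Type u) (G : SimpleGraph W) (A : ℕ → Finset W) (I : Finset ℕ) (r Δ : ℝ),
      1 ≤ r → r₀ ≤ r → 0 < Δ → Δ ≤ δ → M ≤ #I → (∀ x, (A x).Nonempty) → IsSparse G A I Δ →
      Drops G A I q r Δ C L ∨ ∃ τ A', (∀ a ≤ i, τ a ∈ I) ∧ HasOrderType π i τ ∧
        IsFraction l A A' ∧ IsRich G p i A' τ Δ (r ^ expo C i) κ

lemma dichotomy_zero (p π : ℕ → ℕ) (C L q : ℕ) : Dichotomy.{u} p π C L q 0 := by
  intro κ hκ hκ1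
  refine ⟨1, 1, 1, 1, one_pos, one_pos, le_rfl, fun W G A I r Δ hr _ hΔ _ hI hA _ => Or.inr ?_⟩
  obtain ⟨x, hx⟩ := card_pos.mp hI
  refine ⟨fun _ => x, A, fun _ _ => hx, ?_, IsFraction.refl, fun A' hA' => ?_⟩
  · intro a ha b hb hab
    obtain rfl : a = b := by omega
    exact absurd hab (lt_irrefl _)
  · have : #(A' x) ≤ #(copies G p 1 A' fun _ => x) := by
      refine card_le_card_of_injOn (fun v _ => v) (fun v hv => ?_) (fun v _ v' _ h => congrFun h 0)
      refine mem_coe.mpr (mem_copies.mpr ⟨fun _ => hv, fun a b hab => ?_⟩)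
      exact absurd (Subsingleton.elim a b) hab
    simpa [expo] using this

/-- If some index tuple is rich in every large system, then many such tuples can be found,
nested in the prescribed way. -/
lemma Dichotomy.exists_nested {π : ℕ → ℕ} {C L q i : ℕ} (h : Dichotomy.{u} p π C L q i)
    (hπ : ∀ a ≤ i, π a ≠ π (i + 1)) {κ : ℝ} (hκ : 0 < κ) (hκ1 : κ ≤ 1) (n : ℕ) :
    ∃ (M : ℕ) (δ l r₀ : ℝ), 0 < δ ∧ 0 < l ∧ l ≤ 1 ∧
    ∀ (W : Type u) (G : SimpleGraph W) (A : ℕ → Finset W) (I : Finset ℕ) (r Δ : ℝ),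
      1 ≤ r → r₀ ≤ r → 0 < Δ → Δ ≤ δ → M ≤ #I → (∀ x, (A x).Nonempty) → IsSparse G A I Δ →
      Drops G A I q r Δ C L ∨ ∃ (τ : ℕ → ℕ → ℕ) (A' : ℕ → Finset W),
        (∀ j < n, (∀ a ≤ i, τ j a ∈ I) ∧ HasOrderType π i (τ j) ∧
          IsRich G p i A' (τ j) Δ (r ^ expo C i) κ) ∧
        (∀ j j', j < j' → j' < n → ∀ b ≤ i, IsNext π i (τ j) (τ j' b)) ∧
        IsFraction l A A' := by
  induction n with
  | zero =>
    exact ⟨0, 1, 1, 1, one_pos, one_pos, le_rfl, fun W G A I r Δ _ _ _ _ _ _ _ => Or.inr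
      ⟨fun _ _ => 0, A, fun j hj => absurd hj (by omega), fun j j' _ hj' => absurd hj' (by omega),
        IsFraction.refl⟩⟩
  | succ n ih =>
    obtain ⟨M₁, δ₁, l₁, r₁, hδ₁, hl₁, hl₁', h₁⟩ := h κ hκ hκ1
    obtain ⟨M₂, δ₂, l₂, r₂, hδ₂, hl₂, hl₂', h₂⟩ := ih
    refine ⟨M₁ * (M₂ + 1) + M₂, min δ₁ δ₂, min l₁ l₂, max r₁ r₂, lt_min hδ₁ hδ₂, lt_min hl₁ hl₂,
      (min_le_left _ _).trans hl₁', fun W G A I r Δ hr hr₀ hΔ hΔδ hI hA hdeg => ?_⟩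
    -- The first tuple is found among widely spaced indices. The gap where the next index belongs is
    -- still large, and all remaining tuples are found inside it.
    obtain ⟨I', hI'I, hI'M, hspace⟩ := exists_spaced_subset M₁ M₂ hI
    rcases h₁ W G A I' r Δ hr ((le_max_left _ _).trans hr₀) hΔ (hΔδ.trans (min_le_left _ _))
      hI'M.ge hA (hdeg.mono hI'I) with hdrop | ⟨τ₁, A₁, hτ₁, hord, hA₁, hrich₁⟩
    · exact Or.inl (hdrop.mono hI'I)
    set I₂ : Finset ℕ := {x ∈ I | IsNext π i τ₁ x} with hI₂
    have hI₂M : M₂ ≤ #I₂ := by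
      refine (hspace (({a ∈ range (i + 1) | π a < π (i + 1)}).image τ₁) ?_
        (({a ∈ range (i + 1) | π (i + 1) < π a}).image τ₁) ?_ ?_).trans (card_le_card ?_)
      · intro x hx
        obtain ⟨a, ha, rfl⟩ := mem_image.mp hx
        exact hτ₁ a (Nat.lt_succ_iff.mp (mem_range.mp (mem_filter.mp ha).1))
      · intro x hx
        obtain ⟨a, ha, rfl⟩ := mem_image.mp hx
        exact hτ₁ a (Nat.lt_succ_iff.mp (mem_range.mp (mem_filter.mp ha).1))
      · intro x hx y hy
        obtain ⟨a, ha, rfl⟩ := mem_image.mp hx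
        obtain ⟨b, hb, rfl⟩ := mem_image.mp hy
        obtain ⟨ha, ha'⟩ := mem_filter.mp ha
        obtain ⟨hb, hb'⟩ := mem_filter.mp hb
        exact hord a (Nat.lt_succ_iff.mp (mem_range.mp ha)) b
          (Nat.lt_succ_iff.mp (mem_range.mp hb)) (ha'.trans hb')
      · intro x hx
        obtain ⟨hx, h1, h2⟩ := mem_filter.mp hx
        refine mem_filter.mpr ⟨hx, fun a ha => ⟨fun h3 => ?_, fun h3 => ?_⟩⟩
        · exact h1 _ (mem_image_of_mem _ (mem_filter.mpr ⟨mem_range.mpr (by omega), h3⟩))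
        · exact h2 _ (mem_image_of_mem _ (mem_filter.mpr ⟨mem_range.mpr (by omega), h3⟩))
    rcases h₂ W G A I₂ r Δ hr ((le_max_right _ _).trans hr₀) hΔ (hΔδ.trans (min_le_right _ _))
      hI₂M hA (hdeg.mono (filter_subset _ _)) with hdrop | ⟨τ₂, A₂, hτ₂, hnest, hA₂⟩
    · exact Or.inl (hdrop.mono (filter_subset _ _))
    have hnext : ∀ j < n, ∀ b ≤ i, IsNext π i τ₁ (τ₂ j b) := fun j hj b hb =>
      (mem_filter.mp ((hτ₂ j hj).1 b hb)).2
    refine Or.inr ⟨fun j => Nat.casesOn j τ₁ τ₂,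
      fun x => if ∃ a ≤ i, τ₁ a = x then A₁ x else A₂ x, fun j hj => ?_, fun j j' hjj' hj' => ?_,
      fun x => ?_⟩
    · cases j with
      | zero =>
        exact ⟨fun a ha => hI'I (hτ₁ a ha), hord, hrich₁.congr hκ1 fun a ha =>
          (if_pos ⟨a, ha, rfl⟩).symm⟩
      | succ j =>
        have hj' : j < n := by omega
        obtain ⟨h3, h4, h5⟩ := hτ₂ j hj'
        refine ⟨fun a ha => (mem_filter.mp (h3 a ha)).1, h4, h5.congr hκ1 fun b hb =>
          (if_neg ?_).symm⟩
        rintro ⟨a, ha, hab⟩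
        exact (hnext j hj' b hb).ne hπ ha hab
    · cases j' with
      | zero => omega
      | succ j' =>
        cases j with
        | zero => exact hnext j' (by omega)
        | succ j => exact hnest j j' (by omega) (by omega)
    · dsimp only
      split_ifs
      · exact hA₁.mono (min_le_left _ _) x
      · exact hA₂.mono (min_le_right _ _) x

/-- Take `q` nested rich tuples and, for each pair `j < j'`, extend tuple `j` by the parent index of
tuple `j'`. Nesting gives the right order type. Either some extension can be made rich, or all are
low simultaneously and `drops_of_low` applies. -/
lemma Dichotomy.succ (hp : ∀ a, 1 ≤ a → p a < a) (hp0 : p 0 = 0) {π : ℕ → ℕ} {C L q i : ℕ}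
    (hq : 0 < q) (hL : expo C i + 1 ≤ L) (hπ : ∀ a ≤ i + 1, ∀ b ≤ i + 1, π a = π b → a = b)
    (h : Dichotomy.{u} p π C L q i) : Dichotomy.{u} p π C L q (i + 1) := by
  have hπ' : ∀ a ≤ i, π a ≠ π (i + 1) := fun a ha h => by
    have := hπ a (by omega) (i + 1) le_rfl h
    omega
  have hwi : p (i + 1) ≤ i := Nat.lt_succ_iff.mp (hp _ (by omega))
  intro κ hκ hκ1
  set S : Finset (ℕ × ℕ) := {s ∈ range q ×ˢ range q | s.1 < s.2} with hS
  set μ := κ ^ #S with hμ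
  have hμ0 : 0 < μ := pow_pos hκ _
  have hμ1 : μ ≤ 1 := pow_le_one₀ hκ.le hκ1
  -- Making the pairs rich or low shrinks blocks by `μ`; the parameter `μ * (1 / 2)` leaves the
  -- original tuples `1 / 2`-rich afterwards.
  obtain ⟨M, δ, l, r₀, hδ, hl, hl1, hnest⟩ :=
    h.exists_nested hπ' (κ := μ * (1 / 2)) (by positivity) (by linarith) q
  set K := ((κ⁻¹) ^ (i + 1 + 1)) ^ #S with hK
  have hK0 : 0 < K := by positivity
  set l' := l * μ with hl'
  have hl'0 : 0 < l' := by positivity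
  set δ' := l' / (2 * ((q + 1) * (i + 1))) with hδ'
  have hδ'0 : 0 < δ' := by positivity
  have hδ'q : q * i * δ' ≤ l' / 2 := by
    rw [hδ', mul_div_assoc', div_le_div_iff₀ (by positivity) (by positivity)]
    have : (q : ℝ) * i ≤ (q + 1) * (i + 1) := by
      have : (0 : ℝ) ≤ q := Nat.cast_nonneg _
      have : (0 : ℝ) ≤ i := Nat.cast_nonneg _
      nlinarith
    nlinarith
  have hδ'l : δ' ≤ l' := by
    refine div_le_self hl'0.le ?_
    have : (0 : ℝ) ≤ q := Nat.cast_nonneg _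
    have : (0 : ℝ) ≤ i := Nat.cast_nonneg _
    nlinarith
  refine ⟨M, min δ δ', l', max r₀ (max (8 / l' * (4 / δ') ^ i) (64 * q ^ 2 * K * (4 / δ') ^ i)),
    lt_min hδ hδ'0, hl'0, mul_le_one₀ hl1 hμ0.le hμ1, ?_⟩
  intro W G A I r Δ hr hr₀ hΔ hΔδ hI hA hdeg
  have hr1 := (max_le_iff.mp hr₀).1
  obtain ⟨hr2, hr3⟩ := max_le_iff.mp (max_le_iff.mp hr₀).2
  rcases hnest W G A I r Δ hr hr1 hΔ (hΔδ.trans (min_le_left _ _)) hI hA hdeg with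
    hdrop | ⟨τ, A', hτ, hnext, hA'⟩
  · exact Or.inl hdrop
  rcases exists_isRich_or_low (G := G) (p := p) (i := i + 1) (A := A') hΔ
    (pow_nonneg (by linarith : 0 ≤ r) (expo C (i + 1))) hκ hκ1
    (fun s : ℕ × ℕ => Function.update (τ s.1) (i + 1) (τ s.2 (p (i + 1)))) S with
    ⟨s, hs, A'', hA'', hrich⟩ | ⟨A'', hA'', hlow⟩
  · obtain ⟨hs, hs'⟩ := mem_filter.mp hs
    obtain ⟨hs1, hs2⟩ := mem_product.mp hs
    rw [mem_range] at hs1 hs2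
    refine Or.inr ⟨_, A'', fun a ha => ?_,
      (hτ s.1 hs1).2.1.update (hnext s.1 s.2 hs' hs2 _ hwi), hA'.trans hμ0.le hA'', hrich⟩
    rcases eq_or_ne a (i + 1) with rfl | ha'
    · rw [Function.update_self]; exact (hτ s.2 hs2).1 _ hwi
    · rw [Function.update_of_ne ha']; exact (hτ s.1 hs1).1 a (by omega)
  · left
    have hfrac : IsFraction l' A A'' := hA'.trans hμ0.le hA''
    refine drops_of_low hp hp0 (e := expo C i) (τ := τ) (K := K) (δ := δ') hq hΔ hK0 hl'0 hr hL
      (hfrac.nonempty hl'0 hA) hfrac hdeg (fun j hj => (hτ j hj).1) ?_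
      (fun j hj => (hτ j hj).2.2.of_isFraction hA'' (by norm_num) le_rfl) ?_ hδ'0 hδ'q hδ'l
      (hΔδ.trans (min_le_right _ _)) hr2 hr3
    · intro j hj a ha j' hj' b hb hab
      rcases lt_trichotomy j j' with h1 | rfl | h1
      · exact absurd hab ((hnext j j' h1 hj' b hb).ne hπ' ha)
      · exact ⟨rfl, (hτ j hj).2.1.inj (fun a ha b hb => hπ a (by omega) b (by omega)) ha hb hab⟩
      · exact absurd hab.symm ((hnext j' j h1 hj a ha).ne hπ' hb)
    · intro j j' hjj' hj'
      have h1 := hlow (j, j') (mem_filter.mpr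
        ⟨mem_product.mpr ⟨mem_range.mpr (hjj'.trans hj'), mem_range.mpr hj'⟩, hjj'⟩)
      rw [prod_range_succ, Function.update_self, prod_congr rfl (fun a ha => by
        rw [Function.update_of_ne (by have := mem_range.mp ha; omega)])] at h1
      exact h1

lemma expo_mono (C : ℕ) : Monotone (expo C) := monotone_nat_of_le_succ fun i => by
  simp only [expo]; nlinarith

/-! ### Iterated drops -/

/-- If no tuple of blocks ordered according to `π` contains a copy of the tree on `{0, …, k}`,
the relative degrees between some `q` blocks drop polynomially. -/
theorem exists_drop (hp : ∀ a, 1 ≤ a → p a < a) (hp0 : p 0 = 0) {π : ℕ → ℕ} {k : ℕ}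
    (hπ : ∀ a ≤ k, ∀ b ≤ k, π a = π b → a = b) (C : ℕ) {q : ℕ} (hq : 0 < q) :
    ∃ (M : ℕ) (δ r₀ : ℝ), 0 < δ ∧
    ∀ (W : Type u) (G : SimpleGraph W) (A : ℕ → Finset W) (I : Finset ℕ) (r Δ : ℝ),
      1 ≤ r → r₀ ≤ r → 0 < Δ → Δ ≤ δ → M ≤ #I → (∀ x, (A x).Nonempty) → IsSparse G A I Δ →
      (∀ τ, (∀ a ≤ k, τ a ∈ I) → HasOrderType π k τ → copies G p (k + 1) A τ = ∅) →
      Drops G A I q r Δ C (expo C k + 1) := by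
  have key : ∀ i ≤ k, Dichotomy.{u} p π C (expo C k + 1) q i := by
    intro i
    induction i with
    | zero => exact fun _ => dichotomy_zero p π C _ q
    | succ i ih =>
      exact fun hi => (ih (by omega)).succ hp hp0 hq
        (by have := expo_mono C (by omega : i ≤ k); omega)
        (fun a ha b hb => hπ a (by omega) b (by omega))
  -- At the last stage richness of the blocks themselves suffices (`κ = 1`): it forces a copy of the
  -- whole tree.
  obtain ⟨M, δ, l, r₀, hδ, hl, hl1, h⟩ := key k le_rfl 1 one_pos le_rfl
  refine ⟨M, δ, r₀, hδ, fun W G A I r Δ hr hr₀ hΔ hΔδ hI hA hdeg hfree => ?_⟩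
  rcases h W G A I r Δ hr hr₀ hΔ hΔδ hI hA hdeg with hdrop | ⟨τ, A', hτ, hord, hA', hrich⟩
  · exact hdrop
  exfalso
  have h1 := hrich A' IsFraction.refl
  have h2 : copies G p (k + 1) A' τ = ∅ := by
    rw [← subset_empty, ← hfree τ hτ hord]
    exact copies_mono fun a _ => (hA' _).1
  rw [h2] at h1
  have h3 : 0 < Δ ^ k * ∏ a ∈ range (k + 1), (#(A' (τ a)) : ℝ) :=
    mul_pos (pow_pos hΔ _) (prod_pos fun a _ => by
      exact_mod_cast card_pos.mpr (hA'.nonempty hl hA _))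
  simp at h1
  linarith

/-- The hypotheses survive a drop, with `Δ / r ^ (C * l)` for `Δ`, so drops compose and their
exponents add. Since a single drop is bounded, the total exponent `u` can be stopped within a
bounded distance of `d`. -/
theorem exists_iterated_drop (hp : ∀ a, 1 ≤ a → p a < a) (hp0 : p 0 = 0) {π : ℕ → ℕ} {k : ℕ}
    (hπ : ∀ a ≤ k, ∀ b ≤ k, π a = π b → a = b) (C d : ℕ) {q : ℕ} (hq : 0 < q) :
    ∃ (M : ℕ) (δ r₀ : ℝ), 0 < δ ∧
    ∀ (W : Type u) (G : SimpleGraph W) (A : ℕ → Finset W) (I : Finset ℕ) (r Δ : ℝ),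
      1 ≤ r → r₀ ≤ r → 0 < Δ → Δ ≤ δ → M ≤ #I → (∀ x, (A x).Nonempty) → IsSparse G A I Δ →
      (∀ τ, (∀ a ≤ k, τ a ∈ I) → HasOrderType π k τ → copies G p (k + 1) A τ = ∅) →
      ∃ u, d ≤ u ∧ u ≤ d + (expo C k + 1) ∧ ∃ J ⊆ I, #J = q ∧ ∃ B : ℕ → Finset W, ∀ x ∈ J,
        B x ⊆ A x ∧ (#(A x) : ℝ) ≤ r ^ u * #(B x) ∧
        ∀ y ∈ J, x ≠ y → ∀ v ∈ B x, r ^ (C * u) * (deg G v (B y) : ℝ) ≤ Δ * #(B y) := by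
  induction d generalizing q with
  | zero =>
    refine ⟨q, 1, 1, one_pos, fun W G A I r Δ _ _ _ _ hI _ hdeg _ => ?_⟩
    obtain ⟨J, hJ, hJq⟩ := exists_subset_card_eq hI
    exact ⟨0, le_rfl, by omega, J, hJ, hJq, A, fun x hx => ⟨subset_rfl, by simp,
      fun y hy hxy v hv => by simpa using hdeg x (hJ hx) y (hJ hy) hxy v hv⟩⟩
  | succ d ih =>
    obtain ⟨M₁, δ₁, r₁, hδ₁, h₁⟩ := exists_drop.{u} hp hp0 hπ C hq
    -- Keep at least `M₁` blocks so that a further drop is possible if `u = d`, and at least `q` in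
    -- case none is needed.
    obtain ⟨M₂, δ₂, r₂, hδ₂, h₂⟩ := ih (q := max q M₁) (by omega)
    refine ⟨M₂, min δ₁ δ₂, max r₁ r₂, lt_min hδ₁ hδ₂, ?_⟩
    intro W G A I r Δ hr hr₀ hΔ hΔδ hI hA hdeg hfree
    have hr0 : 0 < r := by linarith
    obtain ⟨u, hu, hu', J', hJ', hJ'q, B', hB'⟩ := h₂ W G A I r Δ hr
      ((le_max_right _ _).trans hr₀) hΔ (hΔδ.trans (min_le_right _ _)) hI hA hdeg hfree
    rcases eq_or_lt_of_le hu with rfl | hu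
    swap
    · obtain ⟨J, hJ, hJq⟩ := exists_subset_card_eq (le_trans (le_max_left q M₁) hJ'q.ge)
      exact ⟨u, hu, by omega, J, hJ.trans hJ', hJq, B', fun x hx =>
        ⟨(hB' x (hJ hx)).1, (hB' x (hJ hx)).2.1, fun y hy => (hB' x (hJ hx)).2.2 y (hJ hy)⟩⟩
    set B₁ : ℕ → Finset W := fun x => if x ∈ J' then B' x else A x with hB₁
    have hB₁J : ∀ x ∈ J', B₁ x = B' x := fun x hx => if_pos hx
    have hB₁A : ∀ x, B₁ x ⊆ A x := fun x => by
      by_cases hx : x ∈ J'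
      · rw [hB₁J x hx]; exact (hB' x hx).1
      · rw [hB₁]; simp [hx]
    have hrC : 1 ≤ r ^ (C * d) := one_le_pow₀ hr
    have hrC0 : 0 < r ^ (C * d) := by linarith
    obtain ⟨l, hl, hl', J, hJ, hJq, B, hB⟩ := h₁ W G B₁ J' r (Δ / r ^ (C * d)) hr
      ((le_max_left _ _).trans hr₀) (div_pos hΔ hrC0)
      ((div_le_self hΔ.le hrC).trans (hΔδ.trans (min_le_left _ _)))
      ((le_max_right q M₁).trans hJ'q.ge)
      (fun x => by
        by_cases hx : x ∈ J'
        · rw [hB₁J x hx]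
          have h3 : (0 : ℝ) < #(A x) := by exact_mod_cast card_pos.mpr (hA x)
          have h4 := h3.trans_le (hB' x hx).2.1
          exact card_pos.mp (by exact_mod_cast pos_of_mul_pos_right h4 (pow_pos hr0 d).le)
        · rw [hB₁]; simpa [hx] using hA x)
      (fun x hx y hy hxy v hv => by
        rw [hB₁J x hx] at hv
        rw [hB₁J y hy, div_mul_eq_mul_div, le_div_iff₀ hrC0, mul_comm]
        exact (hB' x hx).2.2 y hy hxy v hv)
      (fun τ hτ hord => by
        rw [← subset_empty, ← hfree τ (fun a ha => hJ' (hτ a ha)) hord]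
        exact copies_mono fun a _ => hB₁A _)
    refine ⟨d + l, by omega, by omega, J, hJ.trans hJ', hJq, B, fun x hx => ?_⟩
    obtain ⟨h3, h4, h5⟩ := hB x hx
    refine ⟨h3.trans (hB₁A x), ?_, fun y hy hxy v hv => ?_⟩
    · rw [hB₁J x (hJ hx)] at h4
      rw [pow_add, mul_assoc]
      exact (hB' x (hJ hx)).2.1.trans (mul_le_mul_of_nonneg_left h4 (pow_pos hr0 d).le)
    · have h6 := h5 y hy hxy v hv
      rw [div_mul_eq_mul_div, le_div_iff₀ hrC0] at h6
      rw [mul_add, pow_add]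
      linarith

/-! ### A Rödl-type theorem for ordered graphs -/

/-- Greedy embedding: either there is an induced transversal copy of `H` in the parts `C a`, or
two of the parts have large subsets which are very sparse or very dense to each other. -/
lemma exists_embedding_or_pair {ε β : ℝ} (hε : 0 < ε) (hε1 : ε ≤ 1) (hβ : 0 < β) :
    ∀ {n : ℕ} (H : SimpleGraph (Fin n)) (C : Fin n → Finset W),
      (∀ a, β * n ≤ ε ^ n * #(C a)) →
      (∃ f : Fin n → W, (∀ a, f a ∈ C a) ∧ ∀ a b, a < b → (G.Adj (f a) (f b) ↔ H.Adj a b)) ∨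
      ∃ a b, a < b ∧ ∃ S ⊆ C a, ∃ S' ⊆ C b, β ≤ #S ∧ β ≤ #S' ∧
        ((∀ x ∈ S, (deg G x S' : ℝ) ≤ ε * #S') ∨ ∀ x ∈ S, (deg Gᶜ x S' : ℝ) ≤ ε * #S') := by
  intro n
  induction n with
  | zero => exact fun H C _ => Or.inl ⟨fun a => a.elim0, fun a => a.elim0, fun a => a.elim0⟩
  | succ n ih =>
    intro H C hC
    have hCβ : ∀ a, β * (n + 1) ≤ #(C a) := fun a => by
      have h1 := hC a
      have h2 : ε ^ (n + 1) * #(C a) ≤ #(C a) :=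
        mul_le_of_le_one_left (Nat.cast_nonneg _) (pow_le_one₀ hε.le hε1)
      push_cast at h1
      linarith
    have hCβ' : ∀ a, β ≤ #(C a) := fun a => by
      refine le_trans ?_ (hCβ a)
      have : (0 : ℝ) ≤ n := Nat.cast_nonneg _
      nlinarith
    -- Vertices unsuitable as the first image because too few candidates for vertex `b.succ` would
    -- remain. A large bad set yields the pair; otherwise the `n` bad sets, each smaller than `β`,
    -- cannot cover `C 0`.
    set bad : Fin n → Finset W := fun b =>
      {x ∈ C 0 | (#{y ∈ C b.succ | G.Adj x y ↔ H.Adj 0 b.succ} : ℝ) < ε * #(C b.succ)}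
      with hbad
    by_cases hlarge : ∃ b, β ≤ #(bad b)
    · obtain ⟨b, hb⟩ := hlarge
      refine Or.inr ⟨0, b.succ, Fin.succ_pos b, bad b, filter_subset _ _, C b.succ, subset_rfl,
        hb, hCβ' _, ?_⟩
      by_cases hadj : H.Adj 0 b.succ
      · left
        intro x hx
        have := (mem_filter.mp hx).2
        simp only [hadj, iff_true] at this
        exact this.le
      · right
        intro x hx
        have := (mem_filter.mp hx).2
        simp only [hadj, iff_false] at this
        refine le_trans ?_ this.le
        have : deg Gᶜ x (C b.succ) ≤ #{y ∈ C b.succ | ¬ G.Adj x y} :=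
          card_le_card fun y hy => by
            simp only [mem_filter, SimpleGraph.compl_adj] at hy ⊢
            exact ⟨hy.1, hy.2.2⟩
        exact_mod_cast this
    push Not at hlarge
    obtain ⟨x, hx, hgood⟩ : ∃ x ∈ C 0, ∀ b, x ∉ bad b := by
      by_contra! hcon
      have h1 : C 0 ⊆ univ.biUnion bad := fun x hx => by
        obtain ⟨b, hb⟩ := hcon x hx
        exact mem_biUnion.mpr ⟨b, mem_univ _, hb⟩
      have h2 : (#(C 0) : ℝ) ≤ ∑ b, (#(bad b) : ℝ) := by
        exact_mod_cast (card_le_card h1).trans card_biUnion_le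
      have h3 : ∑ b, (#(bad b) : ℝ) ≤ ∑ b : Fin n, β := sum_le_sum fun b _ => (hlarge b).le
      have h4 := hCβ 0
      simp at h3
      nlinarith
    rcases ih (H.comap Fin.succ) (fun b => {y ∈ C b.succ | G.Adj x y ↔ H.Adj 0 b.succ}) (by
      intro b
      have h1 : ε * #(C b.succ) ≤ (#{y ∈ C b.succ | G.Adj x y ↔ H.Adj 0 b.succ} : ℝ) := by
        by_contra! hcon
        exact hgood b (mem_filter.mpr ⟨hx, hcon⟩)
      have h2 := mul_le_mul_of_nonneg_left h1 (pow_nonneg hε.le n)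
      have h3 := hC b.succ
      rw [pow_succ] at h3
      push_cast at h3
      linarith) with ⟨f, hf, hf'⟩ | ⟨a, b, hab, S, hS, S', hS', h⟩
    · refine Or.inl ⟨Fin.cons x f, fun a => ?_, fun a b hab => ?_⟩
      · induction a using Fin.cases with
        | zero => simpa using hx
        | succ a => simpa using (mem_filter.mp (hf a)).1
      · induction b using Fin.cases with
        | zero => exact absurd hab (Fin.not_lt_zero a)
        | succ b =>
          induction a using Fin.cases with
          | zero => simpa using (mem_filter.mp (hf b)).2
          | succ a => simpa using hf' a b (Fin.succ_lt_succ_iff.mp hab)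
    · exact Or.inr ⟨a.succ, b.succ, Fin.succ_lt_succ_iff.mpr hab, S,
        hS.trans (filter_subset _ _), S', hS'.trans (filter_subset _ _), h⟩

variable [LinearOrder W]

lemma exists_consecutive_parts {n m : ℕ} {A : Finset W} (hA : n * m ≤ #A) :
    ∃ C : ℕ → Finset W, ∀ i < n, C i ⊆ A ∧ #(C i) = m ∧
      ∀ j, i < j → j < n → ∀ x ∈ C i, ∀ y ∈ C j, x < y := by
  rcases A.eq_empty_or_nonempty with rfl | ⟨a, ha⟩
  · refine ⟨fun _ => ∅, fun i hi => ⟨subset_rfl, ?_, by simp⟩⟩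
    simp at hA ⊢
    omega
  have : Nonempty W := ⟨a⟩
  obtain ⟨g, hgA, hg⟩ := exists_enumeration A
  have hlt : ∀ i < n, ∀ s < m, i * m + s < #A := fun i hi s hs => by
    have := Nat.mul_le_mul_right m (Nat.succ_le_of_lt hi)
    rw [Nat.succ_mul] at this
    omega
  refine ⟨fun i => (range m).image (fun s => g (i * m + s)), fun i hi => ⟨?_, ?_, ?_⟩⟩
  · intro x hx
    obtain ⟨s, hs, rfl⟩ := mem_image.mp hx
    exact hgA _ (hlt i hi s (mem_range.mp hs))
  · rw [card_image_of_injOn, card_range]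
    intro s hs t ht hst
    simp only [coe_range, Set.mem_Iio] at hs ht
    rcases lt_trichotomy s t with h1 | h1 | h1
    · exact absurd hst (hg _ _ (by omega) (hlt i hi t ht)).ne
    · exact h1
    · exact absurd hst (hg _ _ (by omega) (hlt i hi s hs)).ne'
  · intro j hij hj x hx y hy
    obtain ⟨s, hs, rfl⟩ := mem_image.mp hx
    obtain ⟨t, ht, rfl⟩ := mem_image.mp hy
    rw [mem_range] at hs ht
    refine hg _ _ ?_ (hlt j hj t ht)
    have := Nat.mul_le_mul_right m (Nat.succ_le_of_lt hij)
    rw [Nat.succ_mul] at this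
    omega

/-- Cut `A` into consecutive parts, one per vertex of `T`: a transversal embedding then respects the
order automatically, so freeness excludes it. One factor `n + 1` in the constant pays for the
cutting, the other for the greedy embedding, and the 2 for rounding. -/
lemma exists_pair_of_isFree {V : Type*} [Fintype V] [LinearOrder V] {T : SimpleGraph V}
    (hfree : IsFree G T) {ε : ℝ} (hε : 0 < ε) (hε1 : ε ≤ 1) {A : Finset W}
    (hA : 1 ≤ ε ^ Fintype.card V / (2 * (Fintype.card V + 1) ^ 2) * #A) :
    ∃ S ⊆ A, ∃ S' ⊆ A, ε ^ Fintype.card V / (2 * (Fintype.card V + 1) ^ 2) * #A ≤ #S ∧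
      ε ^ Fintype.card V / (2 * (Fintype.card V + 1) ^ 2) * #A ≤ #S' ∧
      (∀ x ∈ S, ∀ y ∈ S', x < y) ∧
      ((∀ x ∈ S, (deg G x S' : ℝ) ≤ ε * #S') ∨ ∀ x ∈ S, (deg Gᶜ x S' : ℝ) ≤ ε * #S') := by
  set n := Fintype.card V with hn
  set β := ε ^ n / (2 * (n + 1) ^ 2) * (#A : ℝ) with hβ
  have hεn : 0 < ε ^ n := pow_pos hε n
  set m := #A / (n + 1) with hm
  obtain ⟨C, hC⟩ := exists_consecutive_parts (n := n) (m := m) (A := A)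
    ((Nat.mul_le_mul_right m (Nat.le_succ n)).trans (Nat.mul_div_le _ _))
  have hmn : (#A : ℝ) ≤ 2 * (n + 1) * m := by
    have h1 : (#A : ℝ) < (n + 1) * (m + 1) := by
      have : #A < (n + 1) * (m + 1) := by
        rw [hm]; exact Nat.lt_mul_div_succ _ (Nat.succ_pos n)
      exact_mod_cast this
    have h2 : (n + 1 : ℝ) ≤ #A := by
      have h3 : ε ^ n / (2 * (n + 1) ^ 2) ≤ 1 / (n + 1 : ℝ) := by
        rw [div_le_div_iff₀ (by positivity) (by positivity)]
        have h4 : ε ^ n ≤ 1 := pow_le_one₀ hε.le hε1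
        have : (0 : ℝ) ≤ n := Nat.cast_nonneg _
        nlinarith
      have h4 := hA.trans (mul_le_mul_of_nonneg_right h3 (Nat.cast_nonneg _))
      rw [div_mul_eq_mul_div, le_div_iff₀ (by positivity)] at h4
      linarith
    have h3 : 1 ≤ m := by
      rw [hm, Nat.one_le_div_iff (Nat.succ_pos n)]
      exact_mod_cast h2
    have h4 : (1 : ℝ) ≤ m := by exact_mod_cast h3
    have : (0 : ℝ) ≤ n := Nat.cast_nonneg _
    nlinarith
  set o : Fin n ≃o V := Fintype.orderIsoFinOfCardEq V rfl with ho
  rcases exists_embedding_or_pair (G := G) hε hε1 (lt_of_lt_of_le one_pos hA)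
    (T.comap o) (fun a => C a) (by
      intro a
      rw [(hC a a.2).2.1]
      have h1 : β ≤ ε ^ n * m / (n + 1) := by
        rw [hβ, div_mul_eq_mul_div, div_le_div_iff₀ (by positivity) (by positivity)]
        calc ε ^ n * #A * (n + 1) ≤ ε ^ n * (2 * (n + 1) * m) * (n + 1) := by gcongr
          _ = _ := by ring
      rw [le_div_iff₀ (by positivity)] at h1
      refine le_trans ?_ h1
      have : 0 ≤ β := by linarith
      nlinarith) with ⟨f, hf, hf'⟩ | ⟨a, b, hab, S, hS, S', hS', h1, h2, h3⟩
  · exfalso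
    have hmono : StrictMono f := fun a b hab =>
      (hC a a.2).2.2 b hab b.2 _ (hf a) _ (hf b)
    refine hfree ⟨⟨⟨fun v => f (o.symm v), hmono.injective.comp o.symm.injective⟩,
      @fun u v => ?_⟩, hmono.comp o.symm.strictMono⟩
    change G.Adj (f (o.symm u)) (f (o.symm v)) ↔ T.Adj u v
    rcases lt_trichotomy u v with h | rfl | h
    · simpa using hf' _ _ (o.symm.strictMono h)
    · simp
    · rw [G.adj_comm, T.adj_comm]
      simpa using hf' _ _ (o.symm.strictMono h)
  · exact ⟨S, hS.trans (hC a a.2).1, S', hS'.trans (hC b b.2).1, h1, h2,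
      fun x hx y hy => (hC a a.2).2.2 b hab b.2 x (hS hx) y (hS' hy), h3⟩

/-- `C 0, …, C (n - 1)` are consecutive subsets of `A`, of size at least `η |A|`, with density at
most `ε` between any two of them. -/
def IsSparseSeq (G : SimpleGraph W) (ε η : ℝ) (A : Finset W) (n : ℕ) (C : ℕ → Finset W) : Prop :=
  ∀ i < n, C i ⊆ A ∧ η * #A ≤ #(C i) ∧ ∀ j, i < j → j < n →
    (∀ x ∈ C i, ∀ y ∈ C j, x < y) ∧ ∀ x ∈ C i, (deg G x (C j) : ℝ) ≤ ε * #(C j)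

lemma IsSparseSeq.of_subset {ε η θ : ℝ} {A S : Finset W} {n : ℕ} {C : ℕ → Finset W}
    (h : IsSparseSeq G ε η S n C) (hη : 0 ≤ η) (hS : S ⊆ A) (hS' : θ * #A ≤ #S) {η' : ℝ}
    (hη' : η' ≤ θ * η) : IsSparseSeq G ε η' A n C := fun i hi =>
  ⟨(h i hi).1.trans hS, by
    have h1 := mul_le_mul_of_nonneg_left hS' hη
    have h2 := mul_le_mul_of_nonneg_right hη' (Nat.cast_nonneg (α := ℝ) #A)
    have h3 := (h i hi).2.1
    linarith, (h i hi).2.2⟩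

/-- Degrees are bounded only towards later sets, so the bound from `S` to the uncut `S'` passes to
every subset of `S`. Hence only `S` is refined and `S'` goes last. -/
lemma IsSparseSeq.snoc {ε η θ : ℝ} {A S S' : Finset W} {n : ℕ} {C : ℕ → Finset W}
    (h : IsSparseSeq G ε η S n C) (hη : 0 ≤ η) (hθ : 0 ≤ θ) (hη1 : η ≤ 1) (hS : S ⊆ A)
    (hθS : θ * #A ≤ #S) (hS' : S' ⊆ A) (hθS' : θ * #A ≤ #S') (hlt : ∀ x ∈ S, ∀ y ∈ S', x < y)
    (hdeg : ∀ x ∈ S, (deg G x S' : ℝ) ≤ ε * #S') {η' : ℝ} (hη' : η' ≤ θ * η) :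
    IsSparseSeq G ε η' A (n + 1) (Function.update C n S') := by
  have h' := h.of_subset hη hS hθS hη'
  intro i hi
  rcases eq_or_ne i n with rfl | hin
  · simp only [Function.update_self]
    refine ⟨hS', ?_, fun j hij hj => by omega⟩
    refine le_trans (mul_le_mul_of_nonneg_right ?_ (Nat.cast_nonneg _)) hθS'
    exact hη'.trans (mul_le_of_le_one_right hθ hη1)
  · simp only [Function.update_of_ne hin]
    obtain ⟨h1, h2, h3⟩ := h' i (by omega)
    refine ⟨h1, h2, fun j hij hj => ?_⟩
    rcases eq_or_ne j n with rfl | hjn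
    · simp only [Function.update_self]
      have h4 := (h i (by omega)).1
      exact ⟨fun x hx => hlt x (h4 hx), fun x hx => hdeg x (h4 hx)⟩
    · simp only [Function.update_of_ne hjn]
      exact h3 j hij (by omega)

/-- A Rödl-type theorem: excluding an ordered graph forces long sequences of consecutive large
sets that are either pairwise sparse or pairwise dense. -/
lemma exists_isSparseSeq {V : Type*} [Fintype V] [LinearOrder V] (T : SimpleGraph V)
    {ε : ℝ} (hε : 0 < ε) (hε1 : ε ≤ 1) (n : ℕ) : ∀ a b, a + b = n →
    ∃ η : ℝ, 0 < η ∧ η ≤ 1 ∧ ∀ (W : Type u) [LinearOrder W] (G : SimpleGraph W), IsFree G T →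
      ∀ A : Finset W, 1 ≤ η * #A →
        (∃ C, IsSparseSeq G ε η A a C) ∨ ∃ C, IsSparseSeq Gᶜ ε η A b C := by
  induction n with
  | zero =>
    intro a b hab
    obtain rfl : a = 0 := by omega
    exact ⟨1, one_pos, le_rfl, fun W _ G _ A _ => Or.inl ⟨fun _ => ∅, fun i hi => by omega⟩⟩
  | succ n ih =>
    intro a b hab
    rcases a with _ | a
    · exact ⟨1, one_pos, le_rfl, fun W _ G _ A _ => Or.inl ⟨fun _ => ∅, fun i hi => by omega⟩⟩
    rcases b with _ | b
    · exact ⟨1, one_pos, le_rfl, fun W _ G _ A _ => Or.inr ⟨fun _ => ∅, fun i hi => by omega⟩⟩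
    obtain ⟨η₁, hη₁, hη₁1, h₁⟩ := ih a (b + 1) (by omega)
    obtain ⟨η₂, hη₂, hη₂1, h₂⟩ := ih (a + 1) b (by omega)
    set θ := ε ^ Fintype.card V / (2 * (Fintype.card V + 1) ^ 2) with hθ
    have hθ0 : 0 < θ := by positivity
    have hθ1 : θ ≤ 1 := by
      rw [hθ, div_le_one (by positivity)]
      have h1 : ε ^ Fintype.card V ≤ 1 := pow_le_one₀ hε.le hε1
      have : (0 : ℝ) ≤ Fintype.card V := Nat.cast_nonneg _
      nlinarith
    have hm0 : 0 < min η₁ η₂ := lt_min hη₁ hη₂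
    have hm1 : min η₁ η₂ ≤ 1 := (min_le_left _ _).trans hη₁1
    have hθη₁ : θ * min η₁ η₂ ≤ θ * η₁ := mul_le_mul_of_nonneg_left (min_le_left _ _) hθ0.le
    have hθη₂ : θ * min η₁ η₂ ≤ θ * η₂ := mul_le_mul_of_nonneg_left (min_le_right _ _) hθ0.le
    refine ⟨θ * min η₁ η₂, by positivity, mul_le_one₀ hθ1 hm0.le hm1, fun W _ G hfree A hA => ?_⟩
    have hA0 : (0 : ℝ) ≤ #A := Nat.cast_nonneg _
    obtain ⟨S, hSA, S', hS'A, hS, hS', hlt, hdeg⟩ := exists_pair_of_isFree hfree hε hε1 (A := A)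
      (hA.trans (mul_le_mul_of_nonneg_right (mul_le_of_le_one_right hθ0.le hm1) hA0))
    have hbig : ∀ η, 0 ≤ η → θ * min η₁ η₂ ≤ θ * η → 1 ≤ η * #S := fun η hη h => by
      have h1 := mul_le_mul_of_nonneg_left hS hη
      have h2 := mul_le_mul_of_nonneg_right h hA0
      linarith
    -- Ramsey-style recursion inside `S`: a sparse pair lowers the demand on the sparse sequence by
    -- one, a dense pair that on the dense sequence.
    rcases hdeg with hdeg | hdeg
    · rcases h₁ W G hfree S (hbig η₁ hη₁.le hθη₁) with ⟨C, hC⟩ | ⟨C, hC⟩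
      · exact Or.inl ⟨_, hC.snoc hη₁.le hθ0.le hη₁1 hSA hS hS'A hS' hlt hdeg hθη₁⟩
      · exact Or.inr ⟨C, hC.of_subset hη₁.le hSA hS hθη₁⟩
    · rcases h₂ W G hfree S (hbig η₂ hη₂.le hθη₂) with ⟨C, hC⟩ | ⟨C, hC⟩
      · exact Or.inl ⟨C, hC.of_subset hη₂.le hSA hS hθη₂⟩
      · exact Or.inr ⟨_, hC.snoc hη₂.le hθ0.le hη₂1 hSA hS hS'A hS' hlt hdeg hθη₂⟩

end OrderedGraph

/-! ### From sparse sequences to pure pairs -/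

namespace OrderedGraph
open Finset
open scoped Classical

variable {W : Type*} {G : SimpleGraph W} {p : ℕ → ℕ}

lemma IsSparseSeq.exists_isSparse [LinearOrder W] {ε η : ℝ} {A : Finset W} {n : ℕ}
    {C : ℕ → Finset W} (h : IsSparseSeq G ε η A n C) (hε : 0 < ε) (hA : 1 ≤ η * #A) :
    ∃ B : ℕ → Finset W, IsSparse G B (range n) (4 * n * ε) ∧
      (∀ x < n, η * #A ≤ 2 * #(B x)) ∧
      ∀ x < n, ∀ y < n, x < y → ∀ v ∈ B x, ∀ w ∈ B y, v < w := by
  have hdens : ∀ x < n, ∀ y < n, x < y →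
      (∑ v ∈ C x, deg G v (C y) : ℝ) ≤ ε * #(C x) * #(C y) := by
    intro x hx y hy hxy
    calc (∑ v ∈ C x, deg G v (C y) : ℝ) ≤ ∑ v ∈ C x, ε * #(C y) :=
          sum_le_sum fun v hv => ((h x hx).2.2 y hxy hy).2 v hv
      _ = _ := by simp; ring
  obtain ⟨B, hB⟩ := exists_trim (G := G) (J := range n) (q := n) (B := C) (by simp)
    (fun x hx => by
      have h1 := (h x (mem_range.mp hx)).2.1
      exact card_pos.mp (by exact_mod_cast one_pos.trans_le (hA.trans h1))) hε
    (fun x hx y hy hxy => by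
      rw [mem_range] at hx hy
      rcases lt_or_gt_of_ne hxy with h1 | h1
      · exact hdens x hx y hy h1
      · have h2 : (∑ v ∈ C x, deg G v (C y) : ℝ) = ∑ v ∈ C y, (deg G v (C x) : ℝ) := by
          exact_mod_cast sum_deg_comm (C x) (C y)
        have := hdens y hy x hx h1
        rw [h2]; linarith)
  refine ⟨B, fun x hx y hy hxy v hv => (hB x hx).2.2 y hy hxy v hv, fun x hx => ?_,
    fun x hx y hy hxy v hv w hw => ?_⟩
  · exact (h x hx).2.1.trans (hB x (mem_range.mpr hx)).2.1
  · exact ((h x hx).2.2 y hxy hy).1 v ((hB x (mem_range.mpr hx)).1 hv) w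
      ((hB y (mem_range.mpr hy)).1 hw)

/-- A parent function encoding a forest, and the positions of its vertices. -/
lemma exists_encoding {V : Type*} [Fintype V] [LinearOrder V] {T : SimpleGraph V}
    (hT : T.IsAcyclic) : ∃ p π : ℕ → ℕ, p 0 = 0 ∧ (∀ a, 1 ≤ a → p a < a) ∧
      Function.Injective π ∧ ∀ (W : Type u) [LinearOrder W] (G : SimpleGraph W), IsFree G T →
      ∀ (A : ℕ → Finset W) (I : Finset ℕ),
        (∀ x ∈ I, ∀ y ∈ I, x < y → ∀ v ∈ A x, ∀ w ∈ A y, v < w) →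
        ∀ τ, (∀ a ≤ Fintype.card V, τ a ∈ I) → HasOrderType π (Fintype.card V) τ →
          copies G p (Fintype.card V + 1) A τ = ∅ := by
  obtain ⟨e, p, he, hinj, hp0, hp, hadj⟩ := exists_parent hT (Fintype.card V) univ rfl
  have hinj' : ∀ u v, e u = e v → u = v := fun u v h => hinj u (mem_univ u) v (mem_univ v) h
  set n := Fintype.card V with hn
  set o : Fin n ≃o V := Fintype.orderIsoFinOfCardEq V rfl with ho
  -- Indices encoding no vertex, such as the extra vertex `0`, get positions `n + a`, beyond all
  -- genuine ones, which keeps `π` injective.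
  set π : ℕ → ℕ := fun a => if h : ∃ v, e v = a then (o.symm h.choose : ℕ) else n + a with hπ
  have hπe : ∀ v, π (e v) = o.symm v := fun v => by
    have h : ∃ u, e u = e v := ⟨v, rfl⟩
    simp only [hπ, h, dif_pos]
    rw [hinj' _ _ h.choose_spec]
  refine ⟨p, π, hp0, hp, fun a b hab => ?_, fun W _ G hfree A I hI τ hτ hord => ?_⟩
  · by_cases ha : ∃ v, e v = a
    · obtain ⟨u, rfl⟩ := ha
      by_cases hb : ∃ v, e v = b
      · obtain ⟨v, rfl⟩ := hb
        rw [hπe, hπe] at hab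
        rw [o.symm.injective (Fin.ext hab)]
      · rw [hπe] at hab
        simp only [hπ, hb, dif_neg, not_false_eq_true] at hab
        have := (o.symm u).2
        omega
    · by_cases hb : ∃ v, e v = b
      · obtain ⟨v, rfl⟩ := hb
        rw [hπe] at hab
        simp only [hπ, ha, dif_neg, not_false_eq_true] at hab
        have := (o.symm v).2
        omega
      · simp only [hπ, ha, hb, dif_neg, not_false_eq_true] at hab
        omega
  · by_contra hne
    obtain ⟨f, hf⟩ := nonempty_iff_ne_empty.mpr hne
    obtain ⟨hfA, hf⟩ := mem_copies.mp hf
    have hlt : ∀ v, e v < n + 1 := fun v => Nat.lt_succ_of_le (he v (mem_univ v)).2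
    have hmono : StrictMono fun v => f ⟨e v, hlt v⟩ := fun u v huv => by
      refine hI _ (hτ (e u) (Nat.lt_succ_iff.mp (hlt u))) _ (hτ (e v) (Nat.lt_succ_iff.mp (hlt v)))
        ?_ _ (hfA ⟨e u, hlt u⟩) _ (hfA ⟨e v, hlt v⟩)
      refine hord _ (Nat.lt_succ_iff.mp (hlt u)) _ (Nat.lt_succ_iff.mp (hlt v)) ?_
      rw [hπe, hπe]
      exact o.symm.strictMono huv
    refine hfree ⟨⟨⟨_, hmono.injective⟩, @fun u v => ?_⟩, hmono⟩
    change G.Adj (f ⟨e u, _⟩) (f ⟨e v, _⟩) ↔ T.Adj u v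
    rcases eq_or_ne u v with rfl | huv
    · simp
    · rw [hf _ _ (fun h => huv (hinj' _ _ (Fin.ext_iff.mp h))), hadj u (mem_univ u) v (mem_univ v)]

/-- Sufficiently many, sufficiently sparse blocks contain a large anticomplete pair. -/
theorem exists_isAnticomplete {V : Type*} [Fintype V] [LinearOrder V] {T : SimpleGraph V}
    (hT : T.IsAcyclic) {c : ℝ} (hc : 0 < c) :
    ∃ (M : ℕ) (δ N : ℝ), 0 < δ ∧ ∀ (W : Type u) [LinearOrder W] (G : SimpleGraph W), IsFree G T →
      ∀ (A : ℕ → Finset W) (I : Finset ℕ) (m : ℝ),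
        (∀ x ∈ I, ∀ y ∈ I, x < y → ∀ v ∈ A x, ∀ w ∈ A y, v < w) → 1 ≤ m → N ≤ m → M ≤ #I →
        (∀ x, (A x).Nonempty) → (∀ x, (#(A x) : ℝ) ≤ m) → IsSparse G A I δ →
        ∃ x ∈ I, ∃ y ∈ I, ∃ Z₁ Z₂, IsAnticomplete G Z₁ Z₂ ∧
          (#(A x) : ℝ) ≤ m ^ c * #Z₁ ∧ (#(A y) : ℝ) ≤ m ^ c * #Z₂ := by
  obtain ⟨p, π, hp0, hp, hπ, hfree⟩ := exists_encoding.{_, u} hT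
  obtain ⟨C, hC⟩ := exists_nat_gt (2 / c)
  have hC0 : (0 : ℝ) < C := lt_trans (by positivity) hC
  set L := expo C (Fintype.card V) + 1 with hL
  have hL0 : (0 : ℝ) < L := by positivity
  obtain ⟨M, δ, r₀, hδ, h⟩ := exists_iterated_drop.{u} hp hp0
    (fun a _ b _ hab => hπ hab : ∀ a ≤ Fintype.card V, ∀ b ≤ Fintype.card V, π a = π b → a = b)
    C L two_pos
  refine ⟨M, min δ (1 / 2), (max r₀ 0) ^ (C * L), by positivity, ?_⟩
  intro W _ G hG A I m hI hm hN hM hA hAm hdeg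
  have hm0 : 0 < m := by linarith
  -- The total exponent `u` lies between `L` and `2 * L`. Then `r ^ (C * u) ≥ m` kills all edges,
  -- while `r ^ u ≤ m ^ (2 / C) ≤ m ^ c` bounds the loss in size.
  set r := m ^ (1 / (C * L) : ℝ) with hr
  have hrCL : r ^ (C * L) = m := by
    rw [hr, ← Real.rpow_natCast, ← Real.rpow_mul hm0.le]
    push_cast
    rw [one_div_mul_cancel (by positivity), Real.rpow_one]
  have hr1 : 1 ≤ r := Real.one_le_rpow hm (by positivity)
  have hr0 : r₀ ≤ r := by
    refine (le_max_left r₀ 0).trans ?_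
    rw [← hrCL] at hN
    refine (pow_le_pow_iff_left₀ (le_max_right _ _) (by linarith) ?_).mp hN
    have : 0 < C * L := by exact_mod_cast mul_pos hC0 hL0
    omega
  obtain ⟨u, hu, hu', J, hJ, hJ2, B, hB⟩ := h W G A I r (min δ (1 / 2)) hr1 hr0 (by positivity)
    (min_le_left _ _) hM hA hdeg (fun τ => hfree W G hG A I hI τ)
  have hsize : ∀ x ∈ J, (#(A x) : ℝ) ≤ m ^ c * #(B x) := by
    intro x hx
    refine (hB x hx).2.1.trans (mul_le_mul_of_nonneg_right ?_ (Nat.cast_nonneg _))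
    calc r ^ u ≤ r ^ (2 * L) := pow_le_pow_right₀ hr1 (by omega)
      _ = m ^ (2 / C : ℝ) := by
        rw [hr, ← Real.rpow_natCast, ← Real.rpow_mul hm0.le]
        congr 1
        push_cast
        field_simp
      _ ≤ m ^ c := by
        refine Real.rpow_le_rpow_of_exponent_le hm ?_
        rw [div_lt_iff₀ hc] at hC
        rw [div_le_iff₀ hC0]
        linarith
  obtain ⟨x, y, hxy, rfl⟩ := card_eq_two.mp hJ2
  have hxJ : x ∈ ({x, y} : Finset ℕ) := by simp
  have hyJ : y ∈ ({x, y} : Finset ℕ) := by simp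
  refine ⟨x, hJ hxJ, y, hJ hyJ, B x, B y, ⟨?_, fun v hv w hw hvw => ?_⟩, hsize x hxJ, hsize y hyJ⟩
  · refine disjoint_left.mpr fun v hv hv' => ?_
    rcases lt_or_gt_of_ne hxy with h1 | h1
    · exact lt_irrefl _ (hI x (hJ hxJ) y (hJ hyJ) h1 v ((hB x hxJ).1 hv) v ((hB y hyJ).1 hv'))
    · exact lt_irrefl _ (hI y (hJ hyJ) x (hJ hxJ) h1 v ((hB y hyJ).1 hv') v ((hB x hxJ).1 hv))
  -- One edge would give `m ≤ min δ (1 / 2) * #(B y) ≤ m / 2`.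
  · have h1 := (hB x hxJ).2.2 y hyJ hxy v hv
    have h2 : (1 : ℝ) ≤ deg G v (B y) := by
      exact_mod_cast card_pos.mpr ⟨w, mem_filter.mpr ⟨hw, hvw⟩⟩
    have h3 : m ≤ r ^ (C * u) := by
      rw [← hrCL]; exact pow_le_pow_right₀ hr1 (Nat.mul_le_mul_left _ hu)
    have h4 : (#(B y) : ℝ) ≤ m := le_trans (by exact_mod_cast card_le_card (hB y hyJ).1) (hAm y)
    have h5 : min δ (1 / 2) * (#(B y) : ℝ) ≤ 1 / 2 * m :=
      mul_le_mul (min_le_right _ _) h4 (Nat.cast_nonneg _) (by norm_num)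
    have h6 : m * 1 ≤ r ^ (C * u) * deg G v (B y) :=
      mul_le_mul h3 h2 zero_le_one (hm0.le.trans h3)
    linarith

lemma IsFree.compl {V : Type*} [LinearOrder V] [LinearOrder W] {T : SimpleGraph V}
    (h : IsFree G Tᶜ) : IsFree Gᶜ T := by
  rintro ⟨f, hf⟩
  refine h ⟨⟨⟨f, hf.injective⟩, @fun u v => ?_⟩, hf⟩
  change G.Adj (f u) (f v) ↔ _
  rw [SimpleGraph.compl_adj, ← f.map_rel_iff, SimpleGraph.compl_adj, not_and, not_not]
  constructor
  · exact fun h1 => ⟨fun h2 => h1.ne (by rw [h2]), fun _ => h1⟩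
  · exact fun h1 => h1.2 (hf.injective.ne h1.1)

/-- The pair of sets found in a graph that contains a sparse sequence. -/
lemma exists_isAnticomplete_of_isSparseSeq {V : Type*} [Fintype V] [LinearOrder V]
    {T : SimpleGraph V} (hT : T.IsAcyclic) {c : ℝ} (hc : 0 < c) :
    ∃ (M : ℕ) (ε N : ℝ), 0 < ε ∧ ε ≤ 1 ∧ ∀ (W : Type u) [Fintype W] [LinearOrder W]
      (G : SimpleGraph W), IsFree G T → ∀ (η : ℝ) (C : ℕ → Finset W), N ≤ Fintype.card W →
        1 ≤ η * Fintype.card W → IsSparseSeq G ε η univ M C →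
        ∃ Z₁ Z₂, IsAnticomplete G Z₁ Z₂ ∧
          η / 2 * (Fintype.card W : ℝ) ^ (1 - c) ≤ #Z₁ ∧
          η / 2 * (Fintype.card W : ℝ) ^ (1 - c) ≤ #Z₂ := by
  obtain ⟨M, δ, N, hδ, h⟩ := exists_isAnticomplete.{_, u} hT hc
  -- Trimming `M` blocks multiplies the density bound by `4 * M`.
  refine ⟨M, min 1 (δ / (4 * (M + 1))), N, by positivity, min_le_left _ _, ?_⟩
  intro W _ _ G hG η C hN hη hC
  obtain ⟨B, hB, hBsize, hBlt⟩ := hC.exists_isSparse (by positivity) (by simpa using hη)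
  simp only [card_univ] at hBsize
  have hB0 : ∀ x < M, (B x).Nonempty := fun x hx => by
    have h1 := hBsize x hx
    by_contra h2
    rw [not_nonempty_iff_eq_empty] at h2
    rw [h2] at h1
    simp at h1
    linarith
  have hn : Nonempty W := by
    by_contra h1
    rw [not_nonempty_iff, ← Fintype.card_eq_zero_iff] at h1
    rw [h1] at hη
    simp at hη
    linarith
  set n := Fintype.card W with hn'
  have hn1 : (1 : ℝ) ≤ n := by exact_mod_cast Fintype.card_pos
  have hn0 : (0 : ℝ) < n := by linarith
  set A : ℕ → Finset W := fun x => if x < M then B x else univ with hAdef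
  have hAB : ∀ x ∈ range M, A x = B x := fun x hx => if_pos (mem_range.mp hx)
  obtain ⟨x, hx, y, hy, Z₁, Z₂, hZ, h1, h2⟩ := h W G hG A (range M) n
    (fun x hx y hy => by
      rw [hAB x hx, hAB y hy]; exact hBlt x (mem_range.mp hx) y (mem_range.mp hy))
    hn1 hN (by simp)
    (fun x => by
      by_cases hx : x < M
      · rw [hAB x (mem_range.mpr hx)]; exact hB0 x hx
      · simp only [hAdef, hx, if_false]; exact univ_nonempty)
    (fun x => by exact_mod_cast card_le_univ _)
    (fun x hx y hy hxy v hv => by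
      rw [hAB x hx] at hv
      rw [hAB y hy]
      refine (hB x hx y hy hxy v hv).trans (mul_le_mul_of_nonneg_right ?_ (Nat.cast_nonneg _))
      calc 4 * M * min 1 (δ / (4 * (M + 1))) ≤ 4 * M * (δ / (4 * (M + 1))) :=
            mul_le_mul_of_nonneg_left (min_le_right _ _) (by positivity)
        _ = (M / (M + 1)) * δ := by field_simp
        _ ≤ δ := mul_le_of_le_one_left hδ.le (by rw [div_le_one (by positivity)]; linarith))
  have hfin : ∀ x ∈ range M, ∀ Z : Finset W, (#(A x) : ℝ) ≤ (n : ℝ) ^ c * #Z →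
      η / 2 * (n : ℝ) ^ (1 - c) ≤ #Z := by
    intro x hx Z hZ
    rw [hAB x hx] at hZ
    have h3 := hBsize x (mem_range.mp hx)
    have h4 : (0 : ℝ) < (n : ℝ) ^ c := Real.rpow_pos_of_pos hn0 c
    rw [Real.rpow_sub hn0, Real.rpow_one, mul_div_assoc', div_le_iff₀ h4]
    linarith
  exact ⟨Z₁, Z₂, hZ, hfin x hx Z₁ h1, hfin y hy Z₂ h2⟩

end OrderedGraph

theorem mainTheorem1 {V : Type*} [Fintype V] [LinearOrder V] (T : SimpleGraph V)
    (hT : T.IsAcyclic) (c : ℝ) (hc : 0 < c) :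
    ∃ ε : ℝ, 0 < ε ∧
      ∀ (W : Type*) [Fintype W] [LinearOrder W] (G : SimpleGraph W),
        1 < Fintype.card W →
        OrderedGraph.IsFree G T →
        OrderedGraph.IsFree G Tᶜ →
        ∃ Z₁ Z₂ : Finset W, OrderedGraph.IsPurePair G Z₁ Z₂ ∧
          ε * (Fintype.card W : ℝ) ^ (1 - c) ≤ (Z₁.card : ℝ) ∧
          ε * (Fintype.card W : ℝ) ^ (1 - c) ≤ (Z₂.card : ℝ) := by
  obtain ⟨M, ε₀, N, hε₀, hε₀1, h⟩ := OrderedGraph.exists_isAnticomplete_of_isSparseSeq hT hc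
  obtain ⟨η, hη, -, hseq⟩ := OrderedGraph.exists_isSparseSeq T hε₀ hε₀1 (M + M) M M rfl
  -- Below `R` vertices the required size is at most `1`, and two single vertices form a pure pair.
  set R : ℝ := max N (1 / η) with hR
  have hR0 : 0 < R := lt_of_lt_of_le (by positivity) (le_max_right _ _)
  refine ⟨min (η / 2) (1 / R), by positivity, fun W _ _ G hW hG hG' => ?_⟩
  have hn1 : (1 : ℝ) ≤ Fintype.card W := by exact_mod_cast hW.le
  have hpow : (0 : ℝ) ≤ (Fintype.card W : ℝ) ^ (1 - c) := Real.rpow_nonneg (by linarith) _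
  rcases le_or_gt R (Fintype.card W) with hbig | hsmall
  · have hN := (le_max_left _ _).trans hbig
    have hη1 : 1 ≤ η * Fintype.card W := by
      have := (le_max_right _ _).trans hbig
      rwa [div_le_iff₀' hη] at this
    have hle := mul_le_mul_of_nonneg_right (min_le_left (η / 2) (1 / R)) hpow
    rcases hseq W G hG Finset.univ (by simpa using hη1) with ⟨C, hC⟩ | ⟨C, hC⟩
    · obtain ⟨Z₁, Z₂, hZ, h1, h2⟩ := h W G hG η C hN hη1 hC
      exact ⟨Z₁, Z₂, Or.inr hZ, hle.trans h1, hle.trans h2⟩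
    · obtain ⟨Z₁, Z₂, hZ, h1, h2⟩ := h W Gᶜ hG'.compl η C hN hη1 hC
      refine ⟨Z₁, Z₂, Or.inl ⟨hZ.1, fun x hx y hy => ?_⟩, hle.trans h1, hle.trans h2⟩
      by_contra hxy
      exact hZ.2 x hx y hy ((SimpleGraph.compl_adj _ _ _).mpr
        ⟨fun hxy' => Finset.disjoint_left.mp hZ.1 hx (hxy' ▸ hy), hxy⟩)
  · obtain ⟨x, y, hxy⟩ := Fintype.exists_pair_of_one_lt_card hW
    have hle : min (η / 2) (1 / R) * (Fintype.card W : ℝ) ^ (1 - c) ≤ 1 := by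
      have h1 : (Fintype.card W : ℝ) ^ (1 - c) ≤ R := by
        refine (Real.rpow_le_rpow_of_exponent_le hn1 (by linarith : 1 - c ≤ 1)).trans ?_
        rw [Real.rpow_one]; exact hsmall.le
      calc _ ≤ 1 / R * R := mul_le_mul (min_le_right _ _) h1 hpow (by positivity)
        _ = 1 := by field_simp
    refine ⟨{x}, {y}, ?_, by simpa using hle, by simpa using hle⟩
    by_cases hadj : G.Adj x y
    · exact Or.inl ⟨by simpa using hxy, by simpa using hadj⟩
    · exact Or.inr ⟨by simpa using hxy, by simpa using hadj⟩
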